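/- Let $n\ge 2$, let $S=\{z\in\mathbb C^n: |z|=1\}$, let $(z|w)=\sum_{j=1}^n z_j\overline{w_j}$, and let $\sigma$ be the Euclidean surface measure on $S$ normalized by $\sigma(S)=1$. For integers $p,q\ge 0$ let $H^{(p,q)}$ be the space of restrictions to $S$ of the polynomials $P(z,\bar z)$ on $\mathbb C^n$ that are harmonic (annihilated by the Euclidean Laplacian of $\mathbb C^n\cong\mathbb R^{2n}$) and bihomogeneous of bidegree $(p,q)$, i.e. $P(\lambda z,\bar\lambda\bar z)=\lambda^p\bar\lambda^q P(z,\bar z)$ for all $\lambda\in\mathbb C$. Write $\partial=\frac{\partial}{\partial w}=\frac12(\partial_x-i\partial_y)$ and $\bar\partial=\frac{\partial}{\partial\bar w}=\frac12(\partial_x+i\partial_y)$ for $w=x+iy\in\mathbb C$. Let $\eta\in S$ and let $f$ be a zonal function on $S$ of the form $f(\xi)=\varphi((\xi|\eta))$, where the profile $\varphi$ is a complex-valued function on the closed unit disc that is real analytic on the open unit disc and whose Taylor series around $0$, $$\sum_{j,k=0}^\infty \frac{\partial^j\bar\partial^k\varphi(0)}{j!\,k!}\,w^j\bar w^k,$$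 is absolutely convergent at every point of the unit circle $|w|=1$. Then for all $p,q\ge 0$ the series $$d_{p,q}(\varphi)=(n-1)!\sum_{k=0}^\infty\frac{\partial^{p+k}\bar\partial^{q+k}\varphi(0)}{k!\,(n-1+p+q+k)!}$$ converges absolutely, and for every $Y\in H^{(p,q)}$ the functions $\overline{Y}f$ and $Yf$ are $\sigma$-integrable on $S$, and $$\int_S \overline{Y(\xi)}\,f(\xi)\,d\sigma(\xi)=d_{p,q}(\varphi)\,\overline{Y(\eta)},\qquad \int_S Y(\xi)\,f(\xi)\,d\sigma(\xi)=d_{q,p}(\varphi)\,Y(\eta).$$ -/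

import Mathlib

open MeasureTheory Metric
open scoped ComplexConjugate Laplacian

noncomputable section

namespace ComplexSphere

/-- Complex `n`-space with its Hermitian norm `|z|² = ∑ |z_j|²`. -/
abbrev Cn (n : ℕ) : Type := EuclideanSpace ℂ (Fin n)

/-- The unit sphere `S = S^{2n-1}` of complex `n`-space. -/
abbrev S (n : ℕ) : Type := sphere (0 : Cn n) 1

/-- The Hermitian product `(z | w) = ∑ z_j * conj w_j` (linear in the first variable). -/
def herm {n : ℕ} (z w : Cn n) : ℂ := ∑ j, z j * conj (w j)

/-- The Euclidean surface measure on the sphere, normalized to total mass one. -/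
def surfaceMeasure (n : ℕ) : Measure (S n) :=
  ((volume : Measure (Cn n)).toSphere Set.univ)⁻¹ • (volume : Measure (Cn n)).toSphere

/-- `F` is a polynomial function on complex `n`-space regarded as a real vector space, that is, a
polynomial with complex coefficients in the coordinates `z_j` (the variables `inl j`) and their
conjugates (the variables `inr j`). -/
def IsPolynomial {n : ℕ} (F : Cn n → ℂ) : Prop :=
  ∃ P : MvPolynomial (Fin n ⊕ Fin n) ℂ,
    ∀ z : Cn n, F z = MvPolynomial.eval (Sum.elim (fun j => z j) (fun j => conj (z j))) P

/-- Bihomogeneous polynomials of bidegree `(p, q)`. -/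
def bihomogeneous (n p q : ℕ) : Set (Cn n → ℂ) :=
  {F | IsPolynomial F ∧ ∀ (c : ℂ) (z : Cn n), F (c • z) = c ^ p * conj c ^ q * F z}

/-- Solid harmonics of bidegree `(p, q)`: the bihomogeneous polynomials annihilated by the Euclidean
Laplacian of the underlying real space of dimension `2n`. -/
def solidHarmonics (n p q : ℕ) : Set (Cn n → ℂ) :=
  {F | F ∈ bihomogeneous n p q ∧ ∀ z, (Δ F) z = 0}

/-- Surface harmonics of bidegree `(p, q)`: restrictions of solid harmonics to the sphere. -/
def surfaceHarmonics (n p q : ℕ) : Set (S n → ℂ) :=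
  {Y | ∃ F ∈ solidHarmonics n p q, ∀ ξ : S n, Y ξ = F ξ}

/-- The operator `∂ = (∂/∂x - i ∂/∂y) / 2` in one complex variable. -/
def dw (φ : ℂ → ℂ) (w : ℂ) : ℂ :=
  (fderiv ℝ φ w 1 - Complex.I * fderiv ℝ φ w Complex.I) / 2

/-- The operator `∂bar = (∂/∂x + i ∂/∂y) / 2` in one complex variable. -/
def dwbar (φ : ℂ → ℂ) (w : ℂ) : ℂ :=
  (fderiv ℝ φ w 1 + Complex.I * fderiv ℝ φ w Complex.I) / 2

/-- The mixed derivative `∂^j ∂bar^k φ (0)`. -/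
def mixedDeriv (φ : ℂ → ℂ) (j k : ℕ) : ℂ := (dw^[j] (dwbar^[k] φ)) 0

/-- The hypotheses on a profile: `φ` is real analytic on the open unit disc, and its Taylor series
around `0` converges absolutely at every point of the unit circle. (The values of `φ` outside the
closed unit disc play no role.) -/
structure IsAdmissibleProfile (φ : ℂ → ℂ) : Prop where
  analytic : AnalyticOnNhd ℝ φ (ball 0 1)
  summable : ∀ w : ℂ, ‖w‖ = 1 →
    Summable fun jk : ℕ × ℕ =>
      ‖mixedDeriv φ jk.1 jk.2 / ((jk.1.factorial : ℂ) * (jk.2.factorial : ℂ)) * w ^ jk.1 * conj w ^ jk.2‖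

/-- The `k`-th term of the series for the coefficient `d_{p,q}(φ)`. -/
def coeffTerm (n : ℕ) (φ : ℂ → ℂ) (p q k : ℕ) : ℂ :=
  mixedDeriv φ (p + k) (q + k) / ((k.factorial : ℂ) * ((n - 1 + p + q + k).factorial : ℂ))

/-- The coefficient `d_{p,q}(φ) = (n-1)! ∑_k ∂^{p+k} ∂bar^{q+k} φ (0) / (k! (n-1+p+q+k)!)`. -/
def coeff (n : ℕ) (φ : ℂ → ℂ) (p q : ℕ) : ℂ :=
  ((n - 1).factorial : ℂ) * ∑' k, coeffTerm n φ p q k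

end ComplexSphere

end

noncomputable section

namespace ComplexSphere

open MvPolynomial Finset

/-! ### Linear forms and directional derivatives of polynomials -/

/-! Expand the profile in its Taylor series and integrate term by term; everything reduces to
integrating `F(ξ) A^j B^k` over the sphere, with `F` harmonic of bidegree `(p, q)`, `A = (ξ|η)` and
`B` its conjugate.

That integral is pure algebra once the sphere is replaced by a Gaussian. For a homogeneous
polynomial the two integrals differ by a Gamma factor (`surface_integral_evalAt`), and the Gaussian
expectation turns multiplication by `z_j` into `∂/∂conj z_j` and conversely (`gaussExp_X_mul`). So
each `A` or `B` can be traded for a directional derivative. Derivatives of harmonic polynomials stay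
harmonic, nonconstant ones have mean zero, and Euler's identity tracks the value at `η`. Only `j + p
= k + q` with `j ≥ q` survives (`gaussExp_harmonic_mul_pow`), and reindexing by `j = q + m`, `k = p
+ m` yields the coefficient (`tsum_zonal`).

The analytic inputs are that the Taylor series represents the profile on the open disc
(`IsAdmissibleProfile.eq_tsum`, by the identity theorem on diameters), that `|(ξ|η)| = 1` has
measure zero when `n ≥ 2`, and that absolute convergence permits exchanging sum and integral
(`funkHecke_solidHarmonic`). -/

lemma pderiv_comm {σ : Type*} (i j : σ) (P : MvPolynomial σ ℂ) :
    pderiv i (pderiv j P) = pderiv j (pderiv i P) := by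
  classical
  ext m
  rcases eq_or_ne i j with rfl | h
  · rfl
  · simp only [coeff_pderiv, Finsupp.add_apply, Finsupp.single_eq_of_ne h,
      Finsupp.single_eq_of_ne h.symm, add_right_comm m]
    push_cast
    ring

lemma pderiv_eq_zero_of_weight_zero {σ : Type*} {w : σ → ℕ} {P : MvPolynomial σ ℂ}
    (h : IsWeightedHomogeneous w P 0) {i : σ} (hi : w i ≠ 0) : pderiv i P = 0 := by
  classical
  ext m
  rw [coeff_pderiv, coeff_zero, h.coeff_eq_zero, zero_mul]
  rw [map_add, Finsupp.weight_single, one_smul]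
  omega

section Directional

variable {σ : Type*} [Fintype σ]

/-- The linear form `∑ v_i X_i`. -/
def linForm (v : σ → ℂ) : MvPolynomial σ ℂ := ∑ i, C (v i) * X i

/-- The derivative in the constant direction `v`. -/
def dirDeriv (v : σ → ℂ) (P : MvPolynomial σ ℂ) : MvPolynomial σ ℂ := ∑ i, C (v i) * pderiv i P

lemma dirDeriv_mul (v : σ → ℂ) (P Q : MvPolynomial σ ℂ) :
    dirDeriv v (P * Q) = dirDeriv v P * Q + P * dirDeriv v Q := by
  simp only [dirDeriv, pderiv_mul, sum_mul, mul_sum, ← sum_add_distrib]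
  exact sum_congr rfl fun i _ => by ring

lemma dirDeriv_linForm (v w : σ → ℂ) : dirDeriv v (linForm w) = C (∑ i, v i * w i) := by
  classical
  simp only [dirDeriv, linForm, map_sum, pderiv_C_mul, pderiv_X, Pi.single_apply]
  exact sum_congr rfl fun i _ => by simp

lemma dirDeriv_pow (v : σ → ℂ) (P : MvPolynomial σ ℂ) (k : ℕ) :
    dirDeriv v (P ^ (k + 1)) = (k + 1) * P ^ k * dirDeriv v P := by
  simp only [dirDeriv, pderiv_pow, mul_sum, Nat.add_sub_cancel]
  refine sum_congr rfl fun i _ => ?_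
  push_cast
  ring

lemma pderiv_dirDeriv (v : σ → ℂ) (i : σ) (P : MvPolynomial σ ℂ) :
    pderiv i (dirDeriv v P) = dirDeriv v (pderiv i P) := by
  simp only [dirDeriv, map_sum, pderiv_C_mul]
  exact sum_congr rfl fun j _ => by rw [pderiv_comm]

/-- Only variables with `v i ≠ 0` constrain `m'`, so the same lemma covers the degree that drops by
one and the degree that is unchanged. -/
lemma isWeightedHomogeneous_dirDeriv {w : σ → ℕ} {P : MvPolynomial σ ℂ} {m m' : ℕ} {v : σ → ℂ}
    (h : IsWeightedHomogeneous w P m) (hv : ∀ i, v i ≠ 0 → m' + w i = m) :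
    IsWeightedHomogeneous w (dirDeriv v P) m' := by
  refine (weightedHomogeneousSubmodule ℂ w m').sum_mem fun i _ => ?_
  rcases eq_or_ne (v i) 0 with h0 | h0
  · simp [h0]
  · exact (h.pderiv (hv i h0)).C_mul _

end Directional

variable {n : ℕ}

/-! ### The Gaussian functional -/

/-- The moment of `z ^ a * conj z ^ b` for the standard complex Gaussian measure on `ℂ`. -/
def diagMoment (a b : ℕ) : ℂ := if a = b then (a.factorial : ℂ) else 0

/-- One-variable integration by parts. The truncated `b - 1` at `b = 0` is harmless because of the
factor `b`. -/
lemma diagMoment_succ_left (a b : ℕ) : diagMoment (a + 1) b = b * diagMoment a (b - 1) := by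
  rcases b with _ | b
  · simp [diagMoment]
  · by_cases h : a = b <;> simp [diagMoment, h, Nat.factorial_succ]

lemma diagMoment_comm (a b : ℕ) : diagMoment a b = diagMoment b a := by
  by_cases h : a = b <;> simp [diagMoment, h, eq_comm]

/-- The moment of a monomial in `z` and `conj z` for the standard Gaussian measure on `ℂⁿ`. -/
def gaussMoment (m : Fin n ⊕ Fin n →₀ ℕ) : ℂ := ∏ j, diagMoment (m (.inl j)) (m (.inr j))

/-- The expectation of a polynomial in `z` and `conj z` for the standard Gaussian measure. -/
def gaussExp : MvPolynomial (Fin n ⊕ Fin n) ℂ →ₗ[ℂ] ℂ :=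
  (basisMonomials (Fin n ⊕ Fin n) ℂ).constr ℂ gaussMoment

lemma gaussExp_monomial (m : Fin n ⊕ Fin n →₀ ℕ) (c : ℂ) :
    gaussExp (monomial m c) = c * gaussMoment m := by
  have h : gaussExp (monomial m 1) = gaussMoment m := by
    have := (basisMonomials (Fin n ⊕ Fin n) ℂ).constr_basis ℂ (gaussMoment (n := n)) m
    rwa [coe_basisMonomials] at this
  rw [← mul_one c, ← smul_eq_mul, ← smul_monomial, map_smul, h, smul_eq_mul, smul_eq_mul, mul_one]

lemma gaussExp_one : gaussExp (1 : MvPolynomial (Fin n ⊕ Fin n) ℂ) = 1 := by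
  rw [← C_1, ← monomial_zero', gaussExp_monomial]
  simp [gaussMoment, diagMoment]

lemma gaussMoment_inl_add (j : Fin n) (m : Fin n ⊕ Fin n →₀ ℕ) :
    gaussMoment (Finsupp.single (.inl j) 1 + m) =
      m (.inr j) * gaussMoment (m - Finsupp.single (.inr j) 1) := by
  classical
  simp only [gaussMoment]
  rw [← mul_prod_erase _ _ (mem_univ j), ← mul_prod_erase _ _ (mem_univ j), ← mul_assoc]
  congr 1
  · simp [add_comm 1, diagMoment_succ_left]
  · refine prod_congr rfl fun i hi => ?_
    have : j ≠ i := (ne_of_mem_erase hi).symm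
    simp [this]

lemma gaussMoment_inr_add (j : Fin n) (m : Fin n ⊕ Fin n →₀ ℕ) :
    gaussMoment (Finsupp.single (.inr j) 1 + m) =
      m (.inl j) * gaussMoment (m - Finsupp.single (.inl j) 1) := by
  classical
  simp only [gaussMoment]
  rw [← mul_prod_erase _ _ (mem_univ j), ← mul_prod_erase _ _ (mem_univ j), ← mul_assoc]
  congr 1
  · simp only [Finsupp.add_apply, Finsupp.single_eq_same, diagMoment_comm (_ : ℕ) (1 + _)]
    simp [add_comm 1, diagMoment_succ_left, diagMoment_comm]
  · refine prod_congr rfl fun i hi => ?_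
    have : j ≠ i := (ne_of_mem_erase hi).symm
    simp [this]

/-- Gaussian integration by parts. -/
lemma gaussExp_X_mul (i : Fin n ⊕ Fin n) (P : MvPolynomial (Fin n ⊕ Fin n) ℂ) :
    gaussExp (X i * P) = gaussExp (pderiv i.swap P) := by
  induction P using MvPolynomial.induction_on' with
  | add p q hp hq => rw [mul_add, map_add, map_add, map_add, hp, hq]
  | monomial m a =>
    rw [X, monomial_mul, pderiv_monomial, gaussExp_monomial, gaussExp_monomial]
    rcases i with j | j
    · rw [gaussMoment_inl_add]
      simp [mul_assoc]
    · rw [gaussMoment_inr_add]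
      simp [mul_assoc]

lemma gaussExp_C_mul (c : ℂ) (P : MvPolynomial (Fin n ⊕ Fin n) ℂ) :
    gaussExp (C c * P) = c * gaussExp P := by
  rw [C_mul', map_smul, smul_eq_mul]

lemma gaussExp_linForm_mul (v : Fin n ⊕ Fin n → ℂ) (P : MvPolynomial (Fin n ⊕ Fin n) ℂ) :
    gaussExp (linForm v * P) = gaussExp (dirDeriv (v ∘ Sum.swap) P) := by
  simp only [linForm, dirDeriv, sum_mul, map_sum, mul_assoc, gaussExp_C_mul, gaussExp_X_mul]
  exact Fintype.sum_equiv (Equiv.sumComm _ _) _ _ fun i => by simp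

/-! ### Harmonic bihomogeneous polynomials -/

/-- A quarter of the Laplacian, in the variables `z` and `conj z`. -/
def polyLap (P : MvPolynomial (Fin n ⊕ Fin n) ℂ) : MvPolynomial (Fin n ⊕ Fin n) ℂ :=
  ∑ j, pderiv (.inl j) (pderiv (.inr j) P)

/-- The weight giving the degree in the variables `z`. -/
def holWeight : Fin n ⊕ Fin n → ℕ := Sum.elim 1 0

/-- The weight giving the degree in the variables `conj z`. -/
def antiWeight : Fin n ⊕ Fin n → ℕ := Sum.elim 0 1

/-- Harmonic polynomials in `z` and `conj z` of bidegree `(p, q)`. -/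
structure IsHarmonicPoly (p q : ℕ) (P : MvPolynomial (Fin n ⊕ Fin n) ℂ) : Prop where
  hol : IsWeightedHomogeneous holWeight P p
  anti : IsWeightedHomogeneous antiWeight P q
  harmonic : polyLap P = 0

lemma polyLap_dirDeriv (v : Fin n ⊕ Fin n → ℂ) (P : MvPolynomial (Fin n ⊕ Fin n) ℂ) :
    polyLap (dirDeriv v P) = dirDeriv v (polyLap P) := by
  simp only [polyLap, pderiv_dirDeriv]
  simp only [dirDeriv, map_sum, mul_sum]
  exact sum_comm

lemma IsHarmonicPoly.dirDeriv_hol {p q : ℕ} {P : MvPolynomial (Fin n ⊕ Fin n) ℂ}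
    (h : IsHarmonicPoly (p + 1) q P) (u : Fin n → ℂ) :
    IsHarmonicPoly p q (dirDeriv (Sum.elim u 0) P) where
  hol := isWeightedHomogeneous_dirDeriv h.hol fun i hi => by
    rcases i with i | i <;> simp_all [holWeight]
  anti := isWeightedHomogeneous_dirDeriv h.anti fun i hi => by
    rcases i with i | i <;> simp_all [antiWeight]
  harmonic := by rw [polyLap_dirDeriv, h.harmonic]; simp [dirDeriv]

lemma IsHarmonicPoly.dirDeriv_anti {p q : ℕ} {P : MvPolynomial (Fin n ⊕ Fin n) ℂ}
    (h : IsHarmonicPoly p (q + 1) P) (u : Fin n → ℂ) :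
    IsHarmonicPoly p q (dirDeriv (Sum.elim 0 u) P) where
  hol := isWeightedHomogeneous_dirDeriv h.hol fun i hi => by
    rcases i with i | i <;> simp_all [holWeight]
  anti := isWeightedHomogeneous_dirDeriv h.anti fun i hi => by
    rcases i with i | i <;> simp_all [antiWeight]
  harmonic := by rw [polyLap_dirDeriv, h.harmonic]; simp [dirDeriv]

lemma IsHarmonicPoly.dirDeriv_hol_eq_zero {q : ℕ} {P : MvPolynomial (Fin n ⊕ Fin n) ℂ}
    (h : IsHarmonicPoly 0 q P) (u : Fin n → ℂ) : dirDeriv (Sum.elim u 0) P = 0 := by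
  refine sum_eq_zero fun i _ => ?_
  rcases i with i | i
  · rw [pderiv_eq_zero_of_weight_zero h.hol (by simp [holWeight]), mul_zero]
  · simp

lemma IsHarmonicPoly.dirDeriv_anti_eq_zero {p : ℕ} {P : MvPolynomial (Fin n ⊕ Fin n) ℂ}
    (h : IsHarmonicPoly p 0 P) (u : Fin n → ℂ) : dirDeriv (Sum.elim 0 u) P = 0 := by
  refine sum_eq_zero fun i _ => ?_
  rcases i with i | i
  · simp
  · rw [pderiv_eq_zero_of_weight_zero h.anti (by simp [antiWeight]), mul_zero]

lemma IsHarmonicPoly.euler_hol {p q : ℕ} {P : MvPolynomial (Fin n ⊕ Fin n) ℂ}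
    (h : IsHarmonicPoly p q P) : ∑ j : Fin n, X (.inl j) * pderiv (.inl j) P = p • P := by
  simpa [holWeight] using h.hol.sum_weight_X_mul_pderiv

lemma IsHarmonicPoly.euler_anti {p q : ℕ} {P : MvPolynomial (Fin n ⊕ Fin n) ℂ}
    (h : IsHarmonicPoly p q P) : ∑ j : Fin n, X (.inr j) * pderiv (.inr j) P = q • P := by
  simpa [antiWeight] using h.anti.sum_weight_X_mul_pderiv

/-- Euler's identity: the direction of differentiation is the evaluation point itself. This carries
the value at `η` through the inductions below. -/
lemma IsHarmonicPoly.eval_dirDeriv_hol {p q : ℕ} {P : MvPolynomial (Fin n ⊕ Fin n) ℂ}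
    (h : IsHarmonicPoly p q P) (u v : Fin n → ℂ) :
    eval (Sum.elim u v) (dirDeriv (Sum.elim u 0) P) = p * eval (Sum.elim u v) P := by
  simpa [dirDeriv] using congrArg (eval (Sum.elim u v)) h.euler_hol

lemma IsHarmonicPoly.eval_dirDeriv_anti {p q : ℕ} {P : MvPolynomial (Fin n ⊕ Fin n) ℂ}
    (h : IsHarmonicPoly p q P) (u v : Fin n → ℂ) :
    eval (Sum.elim u v) (dirDeriv (Sum.elim 0 v) P) = q * eval (Sum.elim u v) P := by
  simpa [dirDeriv] using congrArg (eval (Sum.elim u v)) h.euler_anti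

/-- Nonconstant harmonic polynomials have mean zero. -/
lemma IsHarmonicPoly.gaussExp_eq_zero {p q : ℕ} {P : MvPolynomial (Fin n ⊕ Fin n) ℂ}
    (h : IsHarmonicPoly p q P) (hpq : p ≠ 0 ∨ q ≠ 0) : gaussExp P = 0 := by
  -- Euler's identity writes `p • P` as a sum of `z_j ∂_j P`; integration by parts turns that sum
  -- into the Laplacian of `P`.
  have hp : (p : ℂ) * gaussExp P = 0 := by
    rw [← nsmul_eq_mul, ← map_nsmul, ← h.euler_hol, map_sum]
    simp only [gaussExp_X_mul, ← map_sum, Sum.swap_inl]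
    have : ∑ j : Fin n, pderiv (.inr j) (pderiv (.inl j) P) = 0 := by
      rw [← h.harmonic]
      exact sum_congr rfl fun j _ => pderiv_comm _ _ _
    rw [this, map_zero]
  have hq : (q : ℂ) * gaussExp P = 0 := by
    rw [← nsmul_eq_mul, ← map_nsmul, ← h.euler_anti, map_sum]
    simp only [gaussExp_X_mul, ← map_sum, Sum.swap_inr]
    have : ∑ j : Fin n, pderiv (.inl j) (pderiv (.inr j) P) = 0 := h.harmonic
    rw [this, map_zero]
  rcases hpq with h0 | h0
  · simpa [h0] using hp
  · simpa [h0] using hq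

lemma eq_C_of_bidegree_zero {P : MvPolynomial (Fin n ⊕ Fin n) ℂ} (h : IsHarmonicPoly 0 0 P) :
    P = C (MvPolynomial.coeff 0 P) := by
  classical
  ext m
  rw [coeff_C]
  split_ifs with h0
  · rw [← h0]
  · by_contra hm
    have h1 := h.hol hm
    have h2 := h.anti hm
    rw [Finsupp.weight_apply, Finsupp.sum_fintype _ _ (by simp)] at h1 h2
    apply h0
    ext i
    rcases i with i | i
    · simp [holWeight] at h1; simp [h1 i]
    · simp [antiWeight] at h2; simp [h2 i]

variable {u v : Fin n → ℂ}

/-- Each linear factor in `conj z` becomes a derivative in `z`, which sees only `P`. The mean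
survives only if `k` derivatives exhaust `P`, and the Euler factors multiply to `k!`. For `q = 0`
the value does not depend on `v`. -/
lemma gaussExp_harmonic_mul_pow_anti (k : ℕ) :
    ∀ {p q : ℕ} {P : MvPolynomial (Fin n ⊕ Fin n) ℂ}, IsHarmonicPoly p q P →
      gaussExp (P * linForm (Sum.elim 0 u) ^ k) =
        if q = 0 ∧ p = k then (k.factorial : ℂ) * eval (Sum.elim u v) P else 0 := by
  induction k with
  | zero =>
    intro p q P h
    split_ifs with hc
    · obtain ⟨rfl, rfl⟩ := hc
      rw [eq_C_of_bidegree_zero h, ← mul_one (C _)]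
      simp only [pow_zero, mul_one]
      rw [← mul_one (C _), gaussExp_C_mul, gaussExp_one]
      simp
    · rw [pow_zero, mul_one]
      exact h.gaussExp_eq_zero (by tauto)
  | succ k ih =>
    intro p q P h
    have hs : (Sum.elim 0 u : Fin n ⊕ Fin n → ℂ) ∘ Sum.swap =
        (Sum.elim u 0 : Fin n ⊕ Fin n → ℂ) := by
      ext i; rcases i <;> rfl
    have hd : dirDeriv (Sum.elim u 0) (linForm (Sum.elim 0 u) ^ k) = 0 := by
      rcases k with _ | k
      · simp [dirDeriv]
      · rw [dirDeriv_pow, dirDeriv_linForm]; simp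
    rw [pow_succ', mul_left_comm, gaussExp_linForm_mul, hs, dirDeriv_mul, hd, mul_zero, add_zero]
    rcases p with _ | p
    · rw [h.dirDeriv_hol_eq_zero]; simp
    · rw [ih (h.dirDeriv_hol u), h.eval_dirDeriv_hol]
      simp only [add_left_inj]
      split_ifs with hc
      · rw [hc.2, Nat.factorial_succ]; push_cast; ring
      · rfl

/-- Trade one factor `A` for the derivative along `v` in `conj z`: it either lowers `q` in `P`, or
removes one factor `B`, with multiplicity `k` because `∑ u_j v_j = 1`. -/
lemma gaussExp_harmonic_mul_pow (huv : ∑ j, u j * v j = 1) (j : ℕ) :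
    ∀ (k : ℕ) {p q : ℕ} {P : MvPolynomial (Fin n ⊕ Fin n) ℂ}, IsHarmonicPoly p q P →
      gaussExp (P * linForm (Sum.elim v 0) ^ j * linForm (Sum.elim 0 u) ^ k) =
        if j + p = k + q then
          (j.descFactorial q : ℂ) * k.factorial * eval (Sum.elim u v) P else 0 := by
  induction j with
  | zero =>
    intro k p q P h
    rw [pow_zero, mul_one, gaussExp_harmonic_mul_pow_anti (v := v) k h]
    rcases q with _ | q <;> simp
  | succ j ih =>
    intro k p q P h
    have hs : (Sum.elim v 0 : Fin n ⊕ Fin n → ℂ) ∘ Sum.swap =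
        (Sum.elim 0 v : Fin n ⊕ Fin n → ℂ) := by
      ext i; rcases i <;> rfl
    set A := linForm (Sum.elim v 0 : Fin n ⊕ Fin n → ℂ) with hA
    set B := linForm (Sum.elim 0 u : Fin n ⊕ Fin n → ℂ) with hB
    have hdA : dirDeriv (Sum.elim 0 v) (A ^ j) = 0 := by
      rcases j with _ | j
      · simp [dirDeriv]
      · rw [dirDeriv_pow, hA, dirDeriv_linForm]; simp
    have hdB : dirDeriv (Sum.elim 0 v) B = 1 := by
      rw [hB, dirDeriv_linForm]; simp [mul_comm (v _), huv]
    have key : gaussExp (P * A ^ (j + 1) * B ^ k) =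
        gaussExp (dirDeriv (Sum.elim 0 v) P * A ^ j * B ^ k) +
          gaussExp (P * A ^ j * dirDeriv (Sum.elim 0 v) (B ^ k)) := by
      rw [show P * A ^ (j + 1) * B ^ k = A * (P * A ^ j * B ^ k) by ring, gaussExp_linForm_mul, hs,
        dirDeriv_mul, dirDeriv_mul, hdA, mul_zero, add_zero, map_add]
    have h2 : gaussExp (P * A ^ j * dirDeriv (Sum.elim 0 v) (B ^ k)) = k *
        if j + 1 + p = k + q then
          (j.descFactorial q : ℂ) * (k - 1).factorial * eval (Sum.elim u v) P else 0 := by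
      rcases k with _ | k
      · simp [dirDeriv]
      · rw [dirDeriv_pow, hdB, mul_one, show P * A ^ j * ((k + 1 : MvPolynomial _ ℂ) * B ^ k) =
          C (k + 1 : ℂ) * (P * A ^ j * B ^ k) by simp; ring, gaussExp_C_mul, ih k h]
        have : j + 1 + p = k + 1 + q ↔ j + p = k + q := by omega
        simp [this]
    rw [key, h2]
    rcases q with _ | q
    · rw [h.dirDeriv_anti_eq_zero]
      rcases k with _ | k
      · simp
      · simp only [zero_mul, map_zero, zero_add, Nat.descFactorial_zero, Nat.add_sub_cancel,
          Nat.factorial_succ, mul_ite, mul_zero]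
        congr 1
        push_cast; ring
    · rw [ih k (h.dirDeriv_anti v), h.eval_dirDeriv_anti]
      have : j + 1 + p = k + (q + 1) ↔ j + p = k + q := by omega
      simp only [this]
      split_ifs with hc
      -- The two contributions add up through `(q + 1) + (j - q) = j + 1`. For `k = 0` the rule `k *
      -- (k - 1)! = k!` fails, but `hc` then forces `j ≤ q`, so the factor `j - q` vanishes.
      · rw [Nat.succ_descFactorial_succ, Nat.descFactorial_succ]
        rcases lt_or_ge j q with hjq | hjq
        · simp [Nat.descFactorial_eq_zero_iff_lt.2 hjq]
        · have hk : (k : ℂ) * (k - 1).factorial * (j - q : ℕ) = k.factorial * (j - q : ℕ) := by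
            rcases k with _ | k
            · have : j - q = 0 := by omega
              simp [this]
            · rw [Nat.factorial_succ]; push_cast; simp
          have hj : (j : ℂ) = (j - q : ℕ) + q := by rw [← Nat.cast_add, Nat.sub_add_cancel hjq]
          push_cast
          linear_combination (j.descFactorial q : ℂ) * eval (Sum.elim u v) P * hk -
            (j.descFactorial q : ℂ) * k.factorial * eval (Sum.elim u v) P * hj
      · simp

end ComplexSphere

end

noncomputable section

namespace ComplexSphere

open Filter Topology Set

/-! ### Wirtinger derivatives of real analytic functions -/

section Wirtinger

variable {φ ψ : ℂ → ℂ} {U : Set ℂ}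

lemma analyticOnNhd_fderiv_apply (h : AnalyticOnNhd ℝ φ U) (v : ℂ) :
    AnalyticOnNhd ℝ (fun w => fderiv ℝ φ w v) U :=
  (ContinuousLinearMap.apply ℝ ℂ v).comp_analyticOnNhd h.fderiv

lemma analyticOnNhd_dw (h : AnalyticOnNhd ℝ φ U) : AnalyticOnNhd ℝ (dw φ) U := by
  have : dw φ = fun w => (fderiv ℝ φ w 1 - Complex.I * fderiv ℝ φ w Complex.I) * 2⁻¹ := by
    ext w; rw [dw, div_eq_mul_inv]
  rw [this]
  exact ((analyticOnNhd_fderiv_apply h 1).sub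
    (analyticOnNhd_const.mul (analyticOnNhd_fderiv_apply h Complex.I))).mul analyticOnNhd_const

lemma analyticOnNhd_dwbar (h : AnalyticOnNhd ℝ φ U) : AnalyticOnNhd ℝ (dwbar φ) U := by
  have : dwbar φ = fun w => (fderiv ℝ φ w 1 + Complex.I * fderiv ℝ φ w Complex.I) * 2⁻¹ := by
    ext w; rw [dwbar, div_eq_mul_inv]
  rw [this]
  exact ((analyticOnNhd_fderiv_apply h 1).add
    (analyticOnNhd_const.mul (analyticOnNhd_fderiv_apply h Complex.I))).mul analyticOnNhd_const

lemma analyticOnNhd_iterate_dw (h : AnalyticOnNhd ℝ φ U) (j : ℕ) :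
    AnalyticOnNhd ℝ (dw^[j] φ) U := by
  induction j with
  | zero => exact h
  | succ j ih => rw [Function.iterate_succ_apply']; exact analyticOnNhd_dw ih

lemma analyticOnNhd_iterate_dwbar (h : AnalyticOnNhd ℝ φ U) (k : ℕ) :
    AnalyticOnNhd ℝ (dwbar^[k] φ) U := by
  induction k with
  | zero => exact h
  | succ j ih => rw [Function.iterate_succ_apply']; exact analyticOnNhd_dwbar ih

lemma dw_congr {w : ℂ} (h : φ =ᶠ[𝓝 w] ψ) : dw φ w = dw ψ w := by
  rw [dw, dw, h.fderiv_eq]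

lemma fderiv_dw_apply {w : ℂ} (h : AnalyticAt ℝ φ w) (v : ℂ) :
    fderiv ℝ (dw φ) w v =
      (fderiv ℝ (fderiv ℝ φ) w v 1 - Complex.I * fderiv ℝ (fderiv ℝ φ) w v Complex.I) / 2 := by
  have hd : HasFDerivAt (fderiv ℝ φ) (fderiv ℝ (fderiv ℝ φ) w) w :=
    h.fderiv.differentiableAt.hasFDerivAt
  have h1 := hd.clm_apply (hasFDerivAt_const (1 : ℂ) w)
  have hI := hd.clm_apply (hasFDerivAt_const Complex.I w)
  have := ((h1.sub (hI.const_mul Complex.I)).mul_const (2⁻¹ : ℂ)).fderiv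
  have e : dw φ = fun w => (fderiv ℝ φ w 1 - Complex.I * fderiv ℝ φ w Complex.I) * 2⁻¹ := by
    ext w; rw [dw, div_eq_mul_inv]
  rw [e]
  erw [this]
  simp
  ring

lemma fderiv_dwbar_apply {w : ℂ} (h : AnalyticAt ℝ φ w) (v : ℂ) :
    fderiv ℝ (dwbar φ) w v =
      (fderiv ℝ (fderiv ℝ φ) w v 1 + Complex.I * fderiv ℝ (fderiv ℝ φ) w v Complex.I) / 2 := by
  have hd : HasFDerivAt (fderiv ℝ φ) (fderiv ℝ (fderiv ℝ φ) w) w :=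
    h.fderiv.differentiableAt.hasFDerivAt
  have h1 := hd.clm_apply (hasFDerivAt_const (1 : ℂ) w)
  have hI := hd.clm_apply (hasFDerivAt_const Complex.I w)
  have := ((h1.add (hI.const_mul Complex.I)).mul_const (2⁻¹ : ℂ)).fderiv
  have e : dwbar φ = fun w => (fderiv ℝ φ w 1 + Complex.I * fderiv ℝ φ w Complex.I) * 2⁻¹ := by
    ext w; rw [dwbar, div_eq_mul_inv]
  rw [e]
  erw [this]
  simp
  ring

lemma dwbar_dw_comm {w : ℂ} (h : AnalyticAt ℝ φ w) : dwbar (dw φ) w = dw (dwbar φ) w := by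
  have hs : IsSymmSndFDerivAt ℝ φ w := h.contDiffAt.isSymmSndFDerivAt_of_omega
  rw [dwbar, dw, fderiv_dw_apply h, fderiv_dw_apply h, fderiv_dwbar_apply h, fderiv_dwbar_apply h,
    hs 1 Complex.I]
  ring

lemma dwbar_iterate_dw (hU : IsOpen U) (h : AnalyticOnNhd ℝ φ U) (j : ℕ) :
    EqOn (dwbar (dw^[j] φ)) (dw^[j] (dwbar φ)) U := by
  induction j with
  | zero => exact fun _ _ => rfl
  | succ j ih =>
    intro w hw
    rw [Function.iterate_succ_apply', Function.iterate_succ_apply',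
      dwbar_dw_comm (analyticOnNhd_iterate_dw h j w hw)]
    exact dw_congr (ih.eventuallyEq_of_mem (hU.mem_nhds hw))

lemma fderiv_apply_eq_dw_add_dwbar (w u : ℂ) :
    fderiv ℝ φ w u = u * dw φ w + conj u * dwbar φ w := by
  have hu : u = u.re • (1 : ℂ) + u.im • Complex.I := by simp
  have hc : conj u = u.re - u.im * Complex.I := by
    apply Complex.ext <;> simp
  conv_lhs => rw [hu]
  rw [map_add, map_smul, map_smul, dw, dwbar, hc]
  conv_rhs => enter [1, 1]; rw [hu]
  simp only [Complex.real_smul]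
  linear_combination ((u.im : ℂ) * fderiv ℝ φ w Complex.I) * Complex.I_mul_I

/-- Along a ray `d/dt` acts as `u ∂ + conj u ∂bar`, and the two operators commute on analytic
functions, so the binomial theorem applies. -/
lemma iteratedDeriv_radial (h : AnalyticOnNhd ℝ φ (ball 0 1)) {u : ℂ} (hu : ‖u‖ = 1) (N : ℕ) :
    ∀ t ∈ Ioo (-1 : ℝ) 1, iteratedDeriv N (fun t : ℝ => φ (t • u)) t =
      ∑ jk ∈ Finset.HasAntidiagonal.antidiagonal N, (N.choose jk.1 : ℂ) *
        (u ^ jk.1 * conj u ^ jk.2 * (dw^[jk.1] (dwbar^[jk.2] φ)) (t • u)) := by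
  have hmem : ∀ t ∈ Ioo (-1 : ℝ) 1, t • u ∈ ball (0 : ℂ) 1 := fun t ht => by
    rw [mem_ball_zero_iff, norm_smul, hu, mul_one, Real.norm_eq_abs]
    exact abs_lt.2 ht
  induction N with
  | zero => intro t _; simp
  | succ N ih =>
    intro t ht
    have hev : iteratedDeriv N (fun t : ℝ => φ (t • u)) =ᶠ[𝓝 t] _ :=
      EqOn.eventuallyEq_of_mem ih (isOpen_Ioo.mem_nhds ht)
    rw [iteratedDeriv_succ, hev.deriv_eq, Finset.sum_antidiagonal_choose_succ_mul
      (fun j k => u ^ j * conj u ^ k * (dw^[j] (dwbar^[k] φ)) (t • u)), ← Finset.sum_add_distrib]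
    refine HasDerivAt.deriv (HasDerivAt.fun_sum fun jk hjk => ?_)
    have hA := analyticOnNhd_iterate_dw (analyticOnNhd_iterate_dwbar h jk.2) jk.1
    have hd : HasDerivAt (fun t : ℝ => (dw^[jk.1] (dwbar^[jk.2] φ)) (t • u))
        (fderiv ℝ (dw^[jk.1] (dwbar^[jk.2] φ)) (t • u) ((1 : ℝ) • u)) t :=
      (hA _ (hmem t ht)).differentiableAt.hasFDerivAt.comp_hasDerivAt t
        ((hasDerivAt_id t).smul_const u)
    rw [one_smul, fderiv_apply_eq_dw_add_dwbar,
      dwbar_iterate_dw isOpen_ball (analyticOnNhd_iterate_dwbar h jk.2) jk.1 (hmem t ht),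
      ← Function.iterate_succ_apply' dw, ← Function.iterate_succ_apply' dwbar] at hd
    have hch : N.choose jk.2 = N.choose jk.1 :=
      (Nat.choose_symm_of_eq_add (by rw [← Finset.HasAntidiagonal.mem_antidiagonal.1 hjk])).symm
    refine ((hd.const_mul (u ^ jk.1 * conj u ^ jk.2)).const_mul (N.choose jk.1 : ℂ)).congr_deriv ?_
    simp only [hch, Nat.succ_eq_add_one]
    ring

end Wirtinger

/-! ### The Taylor expansion of an admissible profile -/

/-- The Taylor coefficient of `w ^ j * conj w ^ k`. -/
def taylorCoeff (φ : ℂ → ℂ) (jk : ℕ × ℕ) : ℂ :=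
  mixedDeriv φ jk.1 jk.2 / ((jk.1.factorial : ℂ) * (jk.2.factorial : ℂ))

lemma IsAdmissibleProfile.summable_taylorCoeff {φ : ℂ → ℂ} (h : IsAdmissibleProfile φ) :
    Summable fun jk => ‖taylorCoeff φ jk‖ := by
  simpa [taylorCoeff] using h.summable 1 (by simp)

lemma norm_pow_mul_conj_pow_le {w : ℂ} (hw : ‖w‖ ≤ 1) (j k : ℕ) : ‖w ^ j * conj w ^ k‖ ≤ 1 := by
  rw [norm_mul, norm_pow, norm_pow, RCLike.norm_conj]
  exact mul_le_one₀ (pow_le_one₀ (norm_nonneg _) hw) (by positivity)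
    (pow_le_one₀ (norm_nonneg _) hw)

lemma IsAdmissibleProfile.summable_taylor {φ : ℂ → ℂ} (h : IsAdmissibleProfile φ) {w : ℂ}
    (hw : ‖w‖ ≤ 1) :
    Summable fun jk : ℕ × ℕ => taylorCoeff φ jk * (w ^ jk.1 * conj w ^ jk.2) := by
  refine Summable.of_norm_bounded h.summable_taylorCoeff fun jk => ?_
  rw [norm_mul]
  exact mul_le_of_le_one_right (norm_nonneg _) (norm_pow_mul_conj_pow_le hw _ _)

/-- The homogeneous components of the Taylor series in the direction `u`. -/
def radialCoeff (φ : ℂ → ℂ) (u : ℂ) (N : ℕ) : ℂ :=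
  ∑ jk ∈ Finset.HasAntidiagonal.antidiagonal N, taylorCoeff φ jk * (u ^ jk.1 * conj u ^ jk.2)

lemma IsAdmissibleProfile.summable_norm_radialCoeff {φ : ℂ → ℂ} (h : IsAdmissibleProfile φ) {u : ℂ}
    (hu : ‖u‖ ≤ 1) : Summable fun N => ‖radialCoeff φ u N‖ := by
  have hs := Finset.HasAntidiagonal.sigmaAntidiagonalEquivProd.summable_iff.2 h.summable_taylorCoeff
  refine Summable.of_nonneg_of_le (fun _ => norm_nonneg _) (fun N => ?_) hs.sigma
  rw [tsum_fintype]
  refine (norm_sum_le _ _).trans ?_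
  rw [← Finset.sum_coe_sort (Finset.HasAntidiagonal.antidiagonal N)]
  refine Finset.sum_le_sum fun jk _ => ?_
  rw [norm_mul]
  exact mul_le_of_le_one_right (norm_nonneg _) (norm_pow_mul_conj_pow_le hu _ _)

/-- Grouping by total degree turns the double series into a power series in the one real variable
`t`. -/
lemma IsAdmissibleProfile.tsum_taylor_smul {φ : ℂ → ℂ} (h : IsAdmissibleProfile φ) {u : ℂ} {t : ℝ}
    (hu : ‖t • u‖ ≤ 1) :
    ∑' jk : ℕ × ℕ, taylorCoeff φ jk * ((t • u) ^ jk.1 * conj (t • u) ^ jk.2) =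
      ∑' N : ℕ, t ^ N • radialCoeff φ u N := by
  have hs := Finset.HasAntidiagonal.sigmaAntidiagonalEquivProd.summable_iff.2 (h.summable_taylor hu)
  refine (Finset.HasAntidiagonal.sigmaAntidiagonalEquivProd.tsum_eq _).symm.trans
    (hs.tsum_sigma.trans (tsum_congr fun N => ?_))
  rw [tsum_fintype, radialCoeff, Finset.smul_sum,
    ← Finset.sum_coe_sort (Finset.HasAntidiagonal.antidiagonal N)]
  refine Finset.sum_congr rfl fun jk _ => ?_
  have hN : (t : ℂ) ^ N = t ^ jk.1.1 * t ^ jk.1.2 := by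
    rw [← pow_add, Finset.HasAntidiagonal.mem_antidiagonal.1 jk.2]
  simp only [Function.comp_apply, Finset.HasAntidiagonal.sigmaAntidiagonalEquivProd_apply, Complex.real_smul, map_mul,
    Complex.conj_ofReal, mul_pow, Complex.ofReal_pow, hN]
  ring

lemma IsAdmissibleProfile.iteratedDeriv_zero {φ : ℂ → ℂ} (h : IsAdmissibleProfile φ) {u : ℂ}
    (hu : ‖u‖ = 1) (N : ℕ) : iteratedDeriv N (fun t : ℝ => φ (t • u)) 0 =
      N.factorial * radialCoeff φ u N := by
  rw [iteratedDeriv_radial h.analytic hu N 0 (by simp), radialCoeff, Finset.mul_sum]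
  refine Finset.sum_congr rfl fun jk hjk => ?_
  obtain ⟨j, k⟩ := jk
  obtain rfl := Finset.HasAntidiagonal.mem_antidiagonal.1 hjk
  rw [taylorCoeff, mixedDeriv, zero_smul]
  rw [← Nat.add_choose_mul_factorial_mul_factorial j k, ← Nat.choose_symm_add]
  have hj : (j.factorial : ℂ) ≠ 0 := by exact_mod_cast j.factorial_ne_zero
  have hk : (k.factorial : ℂ) ≠ 0 := by exact_mod_cast k.factorial_ne_zero
  push_cast
  field_simp

/-- An admissible profile is the sum of its Taylor series on the open unit disc. -/
theorem IsAdmissibleProfile.eq_tsum {φ : ℂ → ℂ} (h : IsAdmissibleProfile φ) {w : ℂ} (hw : ‖w‖ < 1) :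
    φ w = ∑' jk : ℕ × ℕ, taylorCoeff φ jk * (w ^ jk.1 * conj w ^ jk.2) := by
  obtain ⟨u, t, hu, ht, rfl⟩ : ∃ (u : ℂ) (t : ℝ), ‖u‖ = 1 ∧ t ∈ ball (0 : ℝ) 1 ∧ t • u = w := by
    rcases eq_or_ne w 0 with rfl | h0
    · exact ⟨1, 0, by simp, by simp, by simp⟩
    · refine ⟨‖w‖⁻¹ • w, ‖w‖, ?_, by simpa using hw, ?_⟩
      · rw [norm_smul, norm_inv, norm_norm, inv_mul_cancel₀ (norm_ne_zero_iff.2 h0)]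
      · rw [smul_smul, mul_inv_cancel₀ (norm_ne_zero_iff.2 h0), one_smul]
  rw [h.tsum_taylor_smul hw.le]
  let P : FormalMultilinearSeries ℝ ℝ ℂ := fun N =>
    ContinuousMultilinearMap.mkPiRing ℝ (Fin N) (radialCoeff φ u N)
  have hP : 1 ≤ P.radius := by
    have := P.le_radius_of_summable (r := 1) (by
      simpa [P] using h.summable_norm_radialCoeff hu.le)
    simpa using this
  have hsum : ∀ t : ℝ, P.sum t = ∑' N : ℕ, t ^ N • radialCoeff φ u N := fun t => by
    simp [FormalMultilinearSeries.sum, P]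
  have hPa : AnalyticOnNhd ℝ P.sum (ball 0 1) := by
    refine P.analyticOnNhd.mono ?_
    rw [← Metric.eball_ofReal]
    exact Metric.eball_subset_eball (by simpa using hP)
  have hga : AnalyticOnNhd ℝ (fun t : ℝ => φ (t • u)) (ball 0 1) := by
    refine h.analytic.comp (t := ball 0 1) ?_ ?_
    · exact ((ContinuousLinearMap.id ℝ ℝ).smulRight u).analyticOnNhd _
    · intro t ht
      simpa [norm_smul, hu] using ht
  -- Analyticity alone gives agreement only near `0`, where the Taylor coefficients match; the
  -- identity theorem then extends it to `(-1, 1)`.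
  have hev : (fun t : ℝ => φ (t • u)) =ᶠ[𝓝 0] P.sum := by
    obtain ⟨p, r, hp⟩ := hga 0 (by simp)
    filter_upwards [Metric.eball_mem_nhds (0 : ℝ) hp.r_pos] with s hs
    have := hp.hasSum_iteratedFDeriv hs
    rw [zero_add] at this
    rw [← this.tsum_eq, hsum]
    refine tsum_congr fun N => ?_
    rw [iteratedFDeriv_apply_eq_iteratedDeriv_mul_prod, h.iteratedDeriv_zero hu]
    have : (N.factorial : ℂ) ≠ 0 := by exact_mod_cast N.factorial_ne_zero
    simp only [Finset.prod_const, Finset.card_univ, Fintype.card_fin, Complex.real_smul]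
    push_cast
    field_simp
  rw [← hsum]
  exact hga.eqOn_of_preconnected_of_eventuallyEq hPa (convex_ball _ _).isPreconnected (by simp) hev ht

end ComplexSphere

end

noncomputable section

namespace ComplexSphere

open Set Real

/-! ### Gaussian moments in the plane -/

lemma integral_norm_pow_gaussian (a : ℕ) :
    ∫ z : ℂ, ‖z‖ ^ (2 * a) * rexp (-‖z‖ ^ 2) = π * a.factorial := by
  have h := Complex.integral_rpow_mul_exp_neg_rpow (p := 2) (q := (2 * a : ℕ)) (by norm_num)
    (by linarith [(Nat.cast_nonneg (2 * a) : (0 : ℝ) ≤ (2 * a : ℕ))])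
  simp only [Real.rpow_natCast, Real.rpow_two] at h
  rw [h, ← Real.Gamma_nat_eq_factorial]
  push_cast
  congr 1
  · ring
  · congr 1; ring

lemma integral_pow_mul_conj_pow_eq_zero {a b : ℕ} (hab : a ≠ b) :
    ∫ z : ℂ, z ^ a * conj z ^ b * (rexp (-‖z‖ ^ 2) : ℂ) = 0 := by
  have hab' : (a : ℂ) - b ≠ 0 := sub_ne_zero.2 (by exact_mod_cast hab)
  -- Chosen so that `c ^ (a - b) = exp (iπ) = -1`: rotation by `c` preserves the measure but negates
  -- the integrand.
  let c : Circle := Circle.exp (π / (a - b : ℝ))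
  have hc : (c : ℂ) ^ a * conj (c : ℂ) ^ b = -1 := by
    have h1 : (c : ℂ) = Complex.exp (π / (a - b) * Complex.I) := by
      simp [c, Circle.coe_exp]
    have h2 : conj (c : ℂ) = Complex.exp (-(π / (a - b) * Complex.I)) := by
      rw [← Circle.coe_inv_eq_conj, Circle.coe_inv, h1, Complex.exp_neg]
    rw [h2, h1, ← Complex.exp_nat_mul, ← Complex.exp_nat_mul, ← Complex.exp_add,
      ← Complex.exp_pi_mul_I]
    congr 1
    field_simp
    ring
  have h := (rotation c).measurePreserving.integral_comp (rotation c).toHomeomorph.measurableEmbedding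
    (fun z : ℂ => z ^ a * conj z ^ b * (rexp (-‖z‖ ^ 2) : ℂ))
  have h3 : ∀ z : ℂ, (rotation c z) ^ a * conj (rotation c z) ^ b * (rexp (-‖rotation c z‖ ^ 2) : ℂ)
      = -(z ^ a * conj z ^ b * (rexp (-‖z‖ ^ 2) : ℂ)) := by
    intro z
    rw [LinearIsometryEquiv.norm_map, rotation_apply, map_mul]
    linear_combination (z ^ a * conj z ^ b * (rexp (-‖z‖ ^ 2) : ℂ)) * hc
  simp only [h3, integral_neg] at h
  exact self_eq_neg.1 h.symm

lemma integral_pow_mul_conj_pow_gaussian (a b : ℕ) :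
    ∫ z : ℂ, z ^ a * conj z ^ b * (rexp (-‖z‖ ^ 2) : ℂ) = π * diagMoment a b := by
  by_cases hab : a = b
  · subst hab
    have : ∀ z : ℂ, z ^ a * conj z ^ a * (rexp (-‖z‖ ^ 2) : ℂ) =
        ((‖z‖ ^ (2 * a) * rexp (-‖z‖ ^ 2) : ℝ) : ℂ) := fun z => by
      rw [← mul_pow, Complex.mul_conj']; push_cast; rw [pow_mul]
    simp only [this]
    rw [integral_complex_ofReal, integral_norm_pow_gaussian, diagMoment, if_pos rfl]
    push_cast; rfl
  · rw [integral_pow_mul_conj_pow_eq_zero hab, diagMoment, if_neg hab, mul_zero]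

/-! ### Monomials in `z` and `conj z` -/

variable {n : ℕ}

/-- The value of a polynomial in `z` and `conj z` at the point `z`. -/
def evalAt (P : MvPolynomial (Fin n ⊕ Fin n) ℂ) (z : Cn n) : ℂ :=
  MvPolynomial.eval (Sum.elim (fun j => z j) (fun j => conj (z j))) P

/-- The function `∏ z_j ^ m_j * conj z_j ^ m_j'`. -/
def monoFun (m : Fin n ⊕ Fin n →₀ ℕ) (z : Cn n) : ℂ :=
  ∏ j, z j ^ m (.inl j) * conj (z j) ^ m (.inr j)

lemma evalAt_monomial (m : Fin n ⊕ Fin n →₀ ℕ) (c : ℂ) (z : Cn n) :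
    evalAt (MvPolynomial.monomial m c) z = c * monoFun m z := by
  rw [evalAt, MvPolynomial.eval_monomial, Finsupp.prod_fintype _ _ (by simp),
    Fintype.prod_sum_type, monoFun, Finset.prod_mul_distrib]
  rfl

lemma evalAt_eq_sum (P : MvPolynomial (Fin n ⊕ Fin n) ℂ) (z : Cn n) :
    evalAt P z = ∑ m ∈ P.support, P.coeff m * monoFun m z := by
  conv_lhs => rw [P.as_sum, evalAt, map_sum]
  exact Finset.sum_congr rfl fun m _ => evalAt_monomial m _ z

lemma continuous_evalAt (P : MvPolynomial (Fin n ⊕ Fin n) ℂ) : Continuous (evalAt P) := by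
  refine (MvPolynomial.continuous_eval P).comp (continuous_pi fun i => ?_)
  rcases i with i | i <;> simp only [Sum.elim_inl, Sum.elim_inr] <;> fun_prop

lemma continuous_monoFun (m : Fin n ⊕ Fin n →₀ ℕ) : Continuous (monoFun m) := by
  unfold monoFun
  fun_prop

/-- The total degree of a monomial. -/
def totalDeg (m : Fin n ⊕ Fin n →₀ ℕ) : ℕ := ∑ j, (m (.inl j) + m (.inr j))

lemma monoFun_smul (m : Fin n ⊕ Fin n →₀ ℕ) (r : ℝ) (z : Cn n) :
    monoFun m (r • z) = r ^ totalDeg m * monoFun m z := by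
  simp only [monoFun, totalDeg, ← Finset.prod_pow_eq_pow_sum, ← Finset.prod_mul_distrib]
  refine Finset.prod_congr rfl fun j _ => ?_
  rw [PiLp.smul_apply, Complex.real_smul, map_mul, Complex.conj_ofReal]
  ring

/-! ### Integration in polar coordinates -/

/-- Both measures are Haar. The constant need not be known, since normalizing the surface measure
eliminates it. -/
lemma exists_integral_eq_mul_integral_pi (n : ℕ) : ∃ c : ℝ, ∀ f : Cn n → ℂ,
    ∫ z, f z = c * ∫ x : Fin n → ℂ, f (WithLp.toLp 2 x) := by
  let e : (Fin n → ℂ) ≃L[ℝ] Cn n := (PiLp.continuousLinearEquiv 2 ℝ (fun _ : Fin n => ℂ)).symm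
  have : (Measure.map e volume).IsAddHaarMeasure := e.isAddHaarMeasure_map _
  refine ⟨Measure.addHaarScalarFactor (volume : Measure (Cn n)) (Measure.map e volume),
    fun f => ?_⟩
  conv_lhs => rw [Measure.isAddLeftInvariant_eq_smul (volume : Measure (Cn n)) (Measure.map e volume)]
  have hmap : ∫ y, f y ∂(Measure.map e volume) = ∫ x, f (e x) :=
    e.toHomeomorph.measurableEmbedding.integral_map f
  rw [integral_smul_nnreal_measure, hmap, NNReal.smul_def, Complex.real_smul]
  rfl

lemma integral_monoFun_gaussian (n : ℕ) : ∃ c : ℂ, ∀ m : Fin n ⊕ Fin n →₀ ℕ,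
    ∫ z : Cn n, monoFun m z * (rexp (-‖z‖ ^ 2) : ℂ) = c * gaussMoment m := by
  obtain ⟨c, hc⟩ := exists_integral_eq_mul_integral_pi n
  refine ⟨c * π ^ n, fun m => ?_⟩
  have h : ∀ x : Fin n → ℂ, monoFun m (WithLp.toLp 2 x) * (rexp (-‖WithLp.toLp 2 x‖ ^ 2) : ℂ) =
      ∏ j, (x j ^ m (.inl j) * conj (x j) ^ m (.inr j) * (rexp (-‖x j‖ ^ 2) : ℂ)) := by
    intro x
    rw [monoFun, EuclideanSpace.norm_sq_eq, ← Finset.sum_neg_distrib, Real.exp_sum,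
      Complex.ofReal_prod, ← Finset.prod_mul_distrib]
  rw [hc]
  simp only [h]
  rw [integral_fintype_prod_volume_eq_prod
    (f := fun j (w : ℂ) => w ^ m (.inl j) * conj w ^ m (.inr j) * (rexp (-‖w‖ ^ 2) : ℂ))]
  simp only [integral_pow_mul_conj_pow_gaussian, Finset.prod_mul_distrib, Finset.prod_const,
    Finset.card_univ, Fintype.card_fin, gaussMoment]
  ring

lemma integral_radial_gaussian {k : ℕ} (D : ℕ) :
    ∫ r : Ioi (0 : ℝ), ((r.1 ^ D * rexp (-r.1 ^ 2) : ℝ) : ℂ) ∂(Measure.volumeIoiPow k) =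
      ((1 / 2 * Real.Gamma ((k + D + 1) / 2) : ℝ) : ℂ) := by
  rw [integral_complex_ofReal]
  congr 1
  have h := integral_rpow_mul_exp_neg_rpow (p := 2) (q := (k + D : ℕ)) (by norm_num)
    (by linarith [(Nat.cast_nonneg (k + D) : (0 : ℝ) ≤ (k + D : ℕ))])
  simp only [Real.rpow_natCast, Real.rpow_two] at h
  push_cast at h
  rw [← h]
  simp only [Measure.volumeIoiPow, ENNReal.ofReal]
  rw [integral_withDensity_eq_integral_smul,
    integral_subtype_comap measurableSet_Ioi
      fun a ↦ Real.toNNReal (a ^ k) • (a ^ D * rexp (-a ^ 2)),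
    setIntegral_congr_fun measurableSet_Ioi fun x hx ↦ ?_]
  · simp only [NNReal.smul_def]
    rw [Real.coe_toNNReal _ (pow_nonneg hx.out.le _), smul_eq_mul, pow_add, mul_assoc]
  · exact (measurable_subtype_coe.pow_const _).real_toNNReal

/-- In polar coordinates homogeneity separates the variables, and the radial integral is a Gamma
value depending only on the degree and the dimension. -/
lemma integral_polar_homogeneous {E : Type*} [NormedAddCommGroup E] [NormedSpace ℝ E]
    [MeasurableSpace E] [BorelSpace E] [FiniteDimensional ℝ E] [Nontrivial E] (μ : Measure E)
    [μ.IsAddHaarMeasure] {G : E → ℂ} {D : ℕ}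
    (hG : ∀ (r : ℝ) (z : E), G (r • z) = r ^ D * G z) :
    ∫ z, G z * (rexp (-‖z‖ ^ 2) : ℂ) ∂μ =
      (∫ ξ : sphere (0 : E) 1, G ξ ∂μ.toSphere) *
        ((1 / 2 * Real.Gamma ((Module.finrank ℝ E + D : ℝ) / 2) : ℝ) : ℂ) := by
  have hd : ((Module.finrank ℝ E - 1 : ℕ) : ℝ) + D + 1 = Module.finrank ℝ E + D := by
    rw [Nat.cast_sub Module.finrank_pos]; push_cast; ring
  calc
    ∫ z, G z * (rexp (-‖z‖ ^ 2) : ℂ) ∂μ =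
        ∫ x : ({(0)}ᶜ : Set E), G x.1 * (rexp (-‖x.1‖ ^ 2) : ℂ) ∂(μ.comap (↑)) := by
      rw [integral_subtype_comap (measurableSet_singleton _).compl
        fun x ↦ G x * (rexp (-‖x‖ ^ 2) : ℂ), restrict_compl_singleton]
    _ = ∫ x : sphere (0 : E) 1 × Ioi (0 : ℝ), G x.1 * ((x.2.1 ^ D * rexp (-x.2.1 ^ 2) : ℝ) : ℂ)
          ∂μ.toSphere.prod (.volumeIoiPow (Module.finrank ℝ E - 1)) := by
      rw [← μ.measurePreserving_homeomorphUnitSphereProd.integral_comp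
        (Homeomorph.measurableEmbedding _)]
      refine integral_congr_ae (Filter.Eventually.of_forall fun x => ?_)
      have hx : (‖x.1‖ : ℝ) ≠ 0 := norm_ne_zero_iff.2 x.2
      simp only [homeomorphUnitSphereProd_apply_fst_coe, homeomorphUnitSphereProd_apply_snd_coe, hG]
      have : (‖x.1‖ : ℂ) ≠ 0 := by exact_mod_cast hx
      have hD : ((‖x.1‖ : ℂ)⁻¹) ^ D * (‖x.1‖ : ℂ) ^ D = 1 := by
        rw [← mul_pow, inv_mul_cancel₀ this, one_pow]
      push_cast
      linear_combination (-G x.1 * Complex.exp (-(‖x.1‖ : ℂ) ^ 2)) * hD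
    _ = _ := by
      rw [integral_prod_mul (fun ξ : sphere (0 : E) 1 => G ξ)
        (fun r : Ioi (0 : ℝ) => ((r.1 ^ D * rexp (-r.1 ^ 2) : ℝ) : ℂ)), integral_radial_gaussian, hd]

/-! ### Moments of the surface measure -/

lemma finrank_Cn (n : ℕ) : Module.finrank ℝ (Cn n) = 2 * n := by
  rw [← Module.finrank_mul_finrank ℝ ℂ (Cn n), Complex.finrank_real_complex,
    finrank_euclideanSpace_fin]

instance nontrivial_Cn [NeZero n] : Nontrivial (Cn n) := by
  apply Module.nontrivial_of_finrank_pos (R := ℝ)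
  rw [finrank_Cn]
  have := NeZero.pos n
  omega

instance isProbabilityMeasure_surfaceMeasure [NeZero n] :
    IsProbabilityMeasure (surfaceMeasure n) where
  measure_univ := by
    rw [surfaceMeasure, Measure.smul_apply, smul_eq_mul]
    exact ENNReal.inv_mul_cancel (Measure.measure_univ_ne_zero.2 (Measure.toSphere_ne_zero _)) (measure_ne_top _ _)

lemma surface_integral_monoFun [NeZero n] (m : Fin n ⊕ Fin n →₀ ℕ) :
    ∫ ξ : S n, monoFun m ξ ∂(surfaceMeasure n) =
      (n - 1).factorial / (n - 1 + ∑ j, m (.inl j)).factorial * gaussMoment m := by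
  obtain ⟨c, hc⟩ := integral_monoFun_gaussian n
  have hn := NeZero.pos n
  have key : ∀ m : Fin n ⊕ Fin n →₀ ℕ, (∫ ξ : S n, monoFun m ξ ∂(surfaceMeasure n)) *
      ((Real.Gamma (n + totalDeg m / 2) : ℝ) : ℂ) =
        2 * c / (volume : Measure (Cn n)).toSphere.real univ * gaussMoment m := by
    intro m
    have h := hc m
    rw [integral_polar_homogeneous volume (monoFun_smul m), finrank_Cn] at h
    rw [surfaceMeasure, integral_smul_measure, ENNReal.toReal_inv, ← measureReal_def]
    rw [show (((2 * n : ℕ) : ℝ) + totalDeg m) / 2 = n + totalDeg m / 2 by push_cast; ring] at h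
    rw [Complex.real_smul]
    push_cast at h ⊢
    rw [mul_assoc, div_mul_eq_mul_div, mul_assoc 2, ← h]
    ring
  -- The case `m = 0` determines the unknown constant: it equals `Γ(n) = (n-1)!`.
  have h0 := key 0
  have hG : ∀ d : ℕ, Real.Gamma (n + d) = (n - 1 + d).factorial := fun d => by
    rw [← Real.Gamma_nat_eq_factorial]
    congr 1
    push_cast [Nat.cast_sub (show 1 ≤ n from hn)]
    ring
  simp only [totalDeg, Finsupp.coe_zero, Pi.zero_apply, add_zero, Finset.sum_const_zero,
    Nat.cast_zero, zero_div] at h0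
  have hG0 := hG 0
  simp only [Nat.cast_zero, add_zero] at hG0
  simp [monoFun, gaussMoment, diagMoment, hG0, -Measure.toSphere_real_apply_univ] at h0
  have hm := key m
  by_cases hmm : ∀ j, m (.inl j) = m (.inr j)
  · have ht : totalDeg m = 2 * ∑ j, m (.inl j) := by
      simp only [totalDeg, ← hmm, ← two_mul, Finset.mul_sum]
    rw [ht] at hm
    rw [show ((2 * ∑ j, m (.inl j) : ℕ) : ℝ) / 2 = (∑ j, m (.inl j) : ℕ) by push_cast; ring, hG,
      ← h0] at hm
    rw [div_mul_eq_mul_div, eq_div_iff (by exact_mod_cast Nat.factorial_ne_zero _)]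
    exact_mod_cast hm
  · push Not at hmm
    obtain ⟨j, hj⟩ := hmm
    have hz : gaussMoment m = 0 := Finset.prod_eq_zero (Finset.mem_univ j) (by simp [diagMoment, hj])
    rw [hz, mul_zero] at hm ⊢
    refine (mul_eq_zero.1 hm).resolve_right ?_
    have : 0 < Real.Gamma (n + totalDeg m / 2) := Real.Gamma_pos_of_pos (by positivity)
    exact_mod_cast this.ne'

lemma integrable_of_continuous_sphere [NeZero n] {g : S n → ℂ} (hg : Continuous g) :
    Integrable g (surfaceMeasure n) :=
  hg.integrable_of_hasCompactSupport (HasCompactSupport.of_compactSpace g)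

/-- The surface integral of a polynomial, in terms of the Gaussian functional. -/
lemma surface_integral_evalAt [NeZero n] {P : MvPolynomial (Fin n ⊕ Fin n) ℂ} {d : ℕ}
    (hP : MvPolynomial.IsWeightedHomogeneous holWeight P d) :
    ∫ ξ : S n, evalAt P ξ ∂(surfaceMeasure n) =
      (n - 1).factorial / (n - 1 + d).factorial * gaussExp P := by
  have h2 : gaussExp P = ∑ m ∈ P.support, P.coeff m * gaussMoment m := by
    conv_lhs => rw [P.as_sum, map_sum]
    exact Finset.sum_congr rfl fun m _ => gaussExp_monomial m _
  simp only [evalAt_eq_sum]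
  rw [h2, Finset.mul_sum, integral_finsetSum]
  · refine Finset.sum_congr rfl fun m hm => ?_
    have hd : ∑ j, m (.inl j) = d := by
      have := hP (MvPolynomial.mem_support_iff.1 hm)
      rw [Finsupp.weight_apply, Finsupp.sum_fintype _ _ (by simp)] at this
      simpa [holWeight] using this
    rw [integral_const_mul, surface_integral_monoFun, hd]
    ring
  · intro m _
    exact (integrable_of_continuous_sphere
      ((continuous_monoFun m).comp continuous_subtype_val)).const_mul _

end ComplexSphere

end

noncomputable section

namespace ComplexSphere

open MvPolynomial Set

variable {n : ℕ}

/-! ### Evaluation of polynomials at `(z, conj z)` -/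

lemma evalAt_mul (P Q : MvPolynomial (Fin n ⊕ Fin n) ℂ) (z : Cn n) :
    evalAt (P * Q) z = evalAt P z * evalAt Q z := map_mul _ _ _

lemma evalAt_pow (P : MvPolynomial (Fin n ⊕ Fin n) ℂ) (k : ℕ) (z : Cn n) :
    evalAt (P ^ k) z = evalAt P z ^ k := map_pow _ _ _

/-- A polynomial in `z` and `conj z` is determined by its values. -/
lemma evalAt_injective : Function.Injective (evalAt (n := n)) := by
  intro P Q hPQ
  -- `ψ` substitutes `x + iy` and `x - iy` for `z` and `conj z`, and `χ` undoes it. This reduces the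
  -- claim to polynomials agreeing at all real points.
  let ψ : MvPolynomial (Fin n ⊕ Fin n) ℂ →ₐ[ℂ] MvPolynomial (Fin n ⊕ Fin n) ℂ :=
    aeval (Sum.elim (fun j => X (.inl j) + C Complex.I * X (.inr j))
      (fun j => X (.inl j) - C Complex.I * X (.inr j)))
  let χ : MvPolynomial (Fin n ⊕ Fin n) ℂ →ₐ[ℂ] MvPolynomial (Fin n ⊕ Fin n) ℂ :=
    aeval (Sum.elim (fun j => C (1 / 2) * (X (.inl j) + X (.inr j)))
      (fun j => C (-Complex.I / 2) * (X (.inl j) - X (.inr j))))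
  have hχψ : χ.comp ψ = AlgHom.id ℂ _ := by
    have h2 : (C (1 / 2) : MvPolynomial (Fin n ⊕ Fin n) ℂ) + C (1 / 2) = 1 := by
      rw [← C_add, ← C_1]; norm_num
    have hI : (C Complex.I : MvPolynomial (Fin n ⊕ Fin n) ℂ) * C (-Complex.I / 2) = C (1 / 2) := by
      rw [← C_mul]
      congr 1
      linear_combination (-1 / 2 : ℂ) * Complex.I_mul_I
    ext i : 1
    rcases i with j | j
    · simp only [ψ, χ, AlgHom.comp_apply, aeval_X, Sum.elim_inl, Sum.elim_inr, map_add, map_mul,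
        algHom_C, AlgHom.id_apply, algebraMap_eq]
      linear_combination (X (.inl j) - X (.inr j)) * hI + X (.inl j) * h2
    · simp only [ψ, χ, AlgHom.comp_apply, aeval_X, Sum.elim_inl, Sum.elim_inr, map_sub, map_mul,
        algHom_C, AlgHom.id_apply, algebraMap_eq]
      linear_combination -(X (.inl j) - X (.inr j)) * hI + X (.inr j) * h2
  have hinj : Function.Injective ψ := Function.LeftInverse.injective (g := χ) fun P =>
    DFunLike.congr_fun hχψ P
  apply hinj
  refine funext_set (fun _ => range ((↑) : ℝ → ℂ))
    (fun _ => infinite_range_of_injective Complex.ofReal_injective) fun x hx => ?_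
  have hx' : ∀ i, conj (x i) = x i := fun i => by
    obtain ⟨r, hr⟩ := hx i (mem_univ i)
    rw [← hr, Complex.conj_ofReal]
  have hev : ∀ R : MvPolynomial (Fin n ⊕ Fin n) ℂ, eval x (ψ R) =
      evalAt R (WithLp.toLp 2 fun j => x (.inl j) + Complex.I * x (.inr j)) := by
    intro R
    rw [evalAt, ← aeval_eq_eval, ← aeval_eq_eval]
    change ((aeval x).comp ψ) R = _
    congr 1
    ext i
    rcases i with j | j <;> simp [ψ, hx', sub_eq_add_neg]
  rw [hev, hev, hPQ]

lemma eq_of_forall_pow_eq {a b p q : ℕ} (h : ∀ c : ℂ, c ^ a * conj c ^ b = c ^ p * conj c ^ q) :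
    a = p ∧ b = q := by
  have hm : ∀ a b : ℕ, ∀ z : Cn 1, evalAt (monomial (Finsupp.single (.inl 0) a +
      Finsupp.single (.inr 0) b) 1) z = z 0 ^ a * conj (z 0) ^ b := fun a b z => by
    rw [evalAt_monomial, monoFun]; simp
  have := monomial_left_injective (one_ne_zero (α := ℂ))
    (evalAt_injective (funext fun z => by rw [hm, hm]; exact h (z 0)) :
      monomial (Finsupp.single (.inl 0) a + Finsupp.single (.inr 0) b) (1 : ℂ) =
        monomial (Finsupp.single (.inl (0 : Fin 1)) p + Finsupp.single (.inr (0 : Fin 1)) q) 1)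
  exact ⟨by simpa using DFunLike.congr_fun this (.inl 0),
    by simpa using DFunLike.congr_fun this (.inr 0)⟩

lemma monoFun_complex_smul (m : Fin n ⊕ Fin n →₀ ℕ) (c : ℂ) (z : Cn n) :
    monoFun m (c • z) = c ^ (∑ j, m (.inl j)) * conj c ^ (∑ j, m (.inr j)) * monoFun m z := by
  simp only [monoFun, ← Finset.prod_pow_eq_pow_sum, ← Finset.prod_mul_distrib]
  refine Finset.prod_congr rfl fun j _ => ?_
  rw [PiLp.smul_apply, smul_eq_mul, map_mul]
  ring

/-- Scaling by `c` multiplies each monomial by its own power of `c` and `conj c`; comparing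
coefficients forces every occurring monomial to have bidegree `(p, q)`. -/
lemma degrees_of_bihomogeneous {P : MvPolynomial (Fin n ⊕ Fin n) ℂ} {p q : ℕ}
    (h : ∀ (c : ℂ) (z : Cn n), evalAt P (c • z) = c ^ p * conj c ^ q * evalAt P z)
    {m : Fin n ⊕ Fin n →₀ ℕ} (hm : P.coeff m ≠ 0) :
    ∑ j, m (.inl j) = p ∧ ∑ j, m (.inr j) = q := by
  classical
  refine eq_of_forall_pow_eq fun c => ?_
  let Q : MvPolynomial (Fin n ⊕ Fin n) ℂ := ∑ m ∈ P.support, monomial m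
    (P.coeff m * (c ^ (∑ j, m (.inl j)) * conj c ^ (∑ j, m (.inr j))))
  have hQ : Q = C (c ^ p * conj c ^ q) * P := by
    refine evalAt_injective (funext fun z => ?_)
    rw [evalAt_mul, show evalAt (C (c ^ p * conj c ^ q)) z = c ^ p * conj c ^ q from eval_C _,
      ← h, evalAt_eq_sum P, evalAt, map_sum]
    refine Finset.sum_congr rfl fun m _ => ?_
    rw [monoFun_complex_smul]
    refine (evalAt_monomial _ _ _).trans ?_
    ring
  have hc := congrArg (MvPolynomial.coeff m) hQ
  rw [coeff_C_mul, coeff_sum, Finset.sum_eq_single m (fun _ _ hne => by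
    rw [coeff_monomial, if_neg hne]) (fun hs => absurd (mem_support_iff.2 hm) hs),
    coeff_monomial, if_pos rfl, mul_comm] at hc
  exact mul_right_cancel₀ hm hc

/-! ### The Laplacian of a polynomial -/

/-- The coordinates of `z` followed by their conjugates. -/
def doubled (v : Cn n) : Fin n ⊕ Fin n → ℂ := Sum.elim (fun j => v j) (fun j => conj (v j))

/-- The map `doubled` as a real continuous linear map. -/
def doubledCLM (i : Fin n ⊕ Fin n) : Cn n →L[ℝ] ℂ :=
  Sum.elim (fun j => (EuclideanSpace.proj j : Cn n →L[ℂ] ℂ).restrictScalars ℝ)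
    (fun j => Complex.conjCLE.toContinuousLinearMap ∘L
      (EuclideanSpace.proj j : Cn n →L[ℂ] ℂ).restrictScalars ℝ) i

lemma doubledCLM_apply (i : Fin n ⊕ Fin n) (v : Cn n) : doubledCLM i v = doubled v i := by
  rcases i with j | j <;> rfl

lemma hasFDerivAt_evalAt (P : MvPolynomial (Fin n ⊕ Fin n) ℂ) (z : Cn n) :
    HasFDerivAt (evalAt P) (∑ i, evalAt (pderiv i P) z • doubledCLM i) z := by
  classical
  induction P using MvPolynomial.induction_on with
  | C a =>
    have : evalAt (C a : MvPolynomial (Fin n ⊕ Fin n) ℂ) = fun _ => a := by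
      ext z; exact eval_C _
    rw [this]
    refine (hasFDerivAt_const (𝕜 := ℝ) a z).congr_fderiv (Finset.sum_eq_zero fun i _ => ?_).symm
    rw [pderiv_C, show evalAt (0 : MvPolynomial (Fin n ⊕ Fin n) ℂ) z = 0 from map_zero _]
    ext v
    exact zero_mul (doubledCLM i v)
  | add P Q hP hQ =>
    have : evalAt (P + Q) = evalAt P + evalAt Q := by ext z; exact map_add _ _ _
    rw [this]
    refine (hP.add hQ).congr_fderiv ?_
    rw [← Finset.sum_add_distrib]
    refine Finset.sum_congr rfl fun i _ => ?_
    rw [map_add, ← add_smul]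
    congr 1
    exact (map_add _ _ _).symm
  | mul_X P i hP =>
    have hX : HasFDerivAt (evalAt (X i : MvPolynomial (Fin n ⊕ Fin n) ℂ)) (doubledCLM i) z := by
      have : evalAt (X i : MvPolynomial (Fin n ⊕ Fin n) ℂ) = doubledCLM i := by
        ext z; rw [doubledCLM_apply]; exact eval_X _
      rw [this]
      exact (doubledCLM i).hasFDerivAt
    have : evalAt (P * X i) = fun z => evalAt P z * evalAt (X i) z := by
      ext z; exact evalAt_mul _ _ _
    rw [this]
    refine (hP.mul hX).congr_fderiv ?_
    ext v
    simp only [pderiv_mul, pderiv_X, add_apply, smul_apply,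
      sum_apply, smul_eq_mul, Finset.mul_sum]
    have : ∀ k, evalAt (pderiv k P * X i + P * Pi.single (M := fun _ => _) k 1 i) z =
        evalAt (pderiv k P) z * evalAt (X i) z + if i = k then evalAt P z else 0 := fun k => by
      rw [← evalAt_mul]
      refine (map_add _ _ _).trans ?_
      congr 1
      by_cases hik : i = k
      · subst hik; simp [evalAt]
      · simp [hik]
    simp only [this, add_mul, Finset.sum_add_distrib, ite_mul, zero_mul, Finset.sum_ite_eq,
      Finset.mem_univ, if_true]
    rw [add_comm]
    congr 1
    exact Finset.sum_congr rfl fun k _ => by ring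

lemma fderiv_evalAt_apply (P : MvPolynomial (Fin n ⊕ Fin n) ℂ) (z v : Cn n) :
    fderiv ℝ (evalAt P) z v = evalAt (dirDeriv (doubled v) P) z := by
  rw [(hasFDerivAt_evalAt P z).fderiv, dirDeriv, evalAt, map_sum]
  simp only [sum_apply, smul_apply, doubledCLM_apply,
    smul_eq_mul]
  refine Finset.sum_congr rfl fun i _ => ?_
  rw [map_mul, eval_C, mul_comm]
  rfl

lemma differentiable_fderiv_evalAt (P : MvPolynomial (Fin n ⊕ Fin n) ℂ) :
    Differentiable ℝ (fderiv ℝ (evalAt P)) := by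
  have : fderiv ℝ (evalAt P) = fun z => ∑ i, evalAt (pderiv i P) z • doubledCLM i := by
    ext1 z; exact (hasFDerivAt_evalAt P z).fderiv
  rw [this]
  exact Differentiable.fun_sum fun i _ z =>
    ((hasFDerivAt_evalAt (pderiv i P) z).differentiableAt).smul_const _

lemma iteratedFDeriv_two_evalAt (P : MvPolynomial (Fin n ⊕ Fin n) ℂ) (z v : Cn n) :
    iteratedFDeriv ℝ 2 (evalAt P) z ![v, v] =
      evalAt (dirDeriv (doubled v) (dirDeriv (doubled v) P)) z := by
  rw [iteratedFDeriv_two_apply, ← fderiv_evalAt_apply]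
  have : evalAt (dirDeriv (doubled v) P) = fun z => fderiv ℝ (evalAt P) z v := by
    ext z; rw [fderiv_evalAt_apply]
  rw [this, fderiv_clm_apply (differentiable_fderiv_evalAt P z) (differentiableAt_const v)]
  simp

/-- In the orthonormal basis `e_j, i e_j` the summands are `(∂ + ∂bar)² + (i∂ - i∂bar)² = 4 ∂ ∂bar`.
-/
lemma laplacian_evalAt (P : MvPolynomial (Fin n ⊕ Fin n) ℂ) (z : Cn n) :
    (Δ (evalAt P)) z = 4 * evalAt (polyLap P) z := by
  classical
  let b : OrthonormalBasis (Fin n × Fin 2) ℝ (Cn n) :=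
    (Pi.orthonormalBasis fun _ ↦ Complex.orthonormalBasisOneI).reindex (Equiv.sigmaEquivProd _ _)
  have hb : ∀ j : Fin n, ∀ k : Fin 2, b (j, k) = PiLp.single 2 j (![1, Complex.I] k) := fun j k => by
    simp [b, OrthonormalBasis.reindex_apply, Pi.orthonormalBasis_apply]
  have hd : ∀ (j : Fin n) (a : ℂ) (Q : MvPolynomial (Fin n ⊕ Fin n) ℂ),
      dirDeriv (doubled (PiLp.single 2 j a : Cn n)) Q =
        C a * pderiv (.inl j) Q + C (conj a) * pderiv (.inr j) Q := fun j a Q => by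
    rw [dirDeriv, Fintype.sum_sum_type, Finset.sum_eq_single j, Finset.sum_eq_single j] <;>
      simp +contextual [doubled]
  rw [InnerProductSpace.laplacian_eq_iteratedFDeriv_orthonormalBasis _ b]
  simp only [iteratedFDeriv_two_evalAt, Fintype.sum_prod_type, Fin.sum_univ_two, hb, hd]
  rw [polyLap, evalAt, map_sum, Finset.mul_sum]
  refine Finset.sum_congr rfl fun j _ => ?_
  simp only [evalAt, Matrix.cons_val_zero, Matrix.cons_val_one, Matrix.cons_val_fin_one, map_add,
    map_one, one_mul, pderiv_C_mul, map_mul, eval_C, Complex.conj_I, map_neg,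
    neg_mul,
    pderiv_comm (Sum.inr j) (Sum.inl j)]
  linear_combination (eval (Sum.elim (fun j => z j) fun j => conj (z j))
    (pderiv (.inl j) (pderiv (.inl j) P)) - 2 * eval (Sum.elim (fun j => z j) fun j => conj (z j))
    (pderiv (.inl j) (pderiv (.inr j) P)) + eval (Sum.elim (fun j => z j) fun j => conj (z j))
    (pderiv (.inr j) (pderiv (.inr j) P))) * Complex.I_mul_I

/-- Solid harmonics are given by harmonic polynomials. -/
lemma exists_isHarmonicPoly {p q : ℕ} {F : Cn n → ℂ} (hF : F ∈ solidHarmonics n p q) :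
    ∃ P, F = evalAt P ∧ IsHarmonicPoly p q P := by
  obtain ⟨⟨⟨P, hP⟩, hb⟩, hΔ⟩ := hF
  obtain rfl : F = evalAt P := funext hP
  refine ⟨P, rfl, fun m hm => ?_, fun m hm => ?_, evalAt_injective (funext fun z => ?_)⟩
  · rw [Finsupp.weight_apply, Finsupp.sum_fintype _ _ (by simp)]
    simpa [holWeight] using (degrees_of_bihomogeneous hb hm).1
  · rw [Finsupp.weight_apply, Finsupp.sum_fintype _ _ (by simp)]
    simpa [antiWeight] using (degrees_of_bihomogeneous hb hm).2
  · have := hΔ z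
    rw [laplacian_evalAt] at this
    rw [(mul_eq_zero.1 this).resolve_left (by norm_num)]
    exact (map_zero _).symm

lemma conj_mem_solidHarmonics {p q : ℕ} {F : Cn n → ℂ} (hF : F ∈ solidHarmonics n p q) :
    (fun z => conj (F z)) ∈ solidHarmonics n q p := by
  obtain ⟨⟨⟨P, hP⟩, hb⟩, hΔ⟩ := hF
  refine ⟨⟨⟨rename Sum.swap (map (starRingEnd ℂ) P), fun z => ?_⟩, fun c z => ?_⟩, fun z => ?_⟩
  · change conj (F z) = _
    rw [eval_rename, hP, eval_map, ← eval₂_id, eval₂_comp_left]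
    congr 1
    ext i
    rcases i with i | i <;> simp
  · simp only [hb, map_mul, map_pow, Complex.conj_conj]
    ring
  · have h := InnerProductSpace.laplacian_CLE_comp_left (l := Complex.conjCLE) (f := F)
    have h' := congrFun h z
    simp only [Function.comp_apply, hΔ z, map_zero] at h'
    exact h'

end ComplexSphere

end

noncomputable section

namespace ComplexSphere

open Set
open scoped Pointwise

variable {n : ℕ}

/-! ### The Hermitian product on the sphere. -/

lemma norm_sphere (ξ : S n) : ‖ξ.1‖ = 1 := by simp

lemma herm_eq_inner (z w : Cn n) : herm z w = inner ℂ w z := by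
  simp [herm, PiLp.inner_apply]

lemma sum_mul_conj_eq_one (η : S n) : ∑ j, η.1 j * conj (η.1 j) = 1 := by
  have := herm_eq_inner η.1 η.1
  rw [inner_self_eq_norm_sq_to_K, norm_sphere] at this
  simpa [herm] using this

lemma norm_herm_le_one (ξ η : S n) : ‖herm ξ.1 η.1‖ ≤ 1 := by
  rw [herm_eq_inner]
  refine (norm_inner_le_norm _ _).trans ?_
  rw [norm_sphere, norm_sphere, one_mul]

lemma continuous_herm (η : S n) : Continuous fun ξ : S n => herm ξ.1 η.1 := by
  simp only [herm_eq_inner]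
  exact continuous_const.inner continuous_subtype_val

/-! ### The circle where the zonal variable has modulus one is a null set -/

/-- Equality in Cauchy–Schwarz puts `ξ` on the complex line through `η`. For `n ≥ 2` this is a
proper real subspace, so the cone over the set, which defines its surface measure, is Lebesgue null.
-/
lemma surfaceMeasure_norm_herm_eq_one (hn : 2 ≤ n) (η : S n) :
    surfaceMeasure n {ξ : S n | ‖herm ξ.1 η.1‖ = 1} = 0 := by
  have hm : MeasurableSet {ξ : S n | ‖herm ξ.1 η.1‖ = 1} :=
    (isClosed_eq (continuous_herm η).norm continuous_const).measurableSet
  let V : Submodule ℝ (Cn n) := (Submodule.span ℂ {η.1}).restrictScalars ℝ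
  have hV : V ≠ ⊤ := by
    intro h
    have h' : Submodule.span ℂ {η.1} = ⊤ := (Submodule.restrictScalars_eq_top_iff ℝ ℂ (Cn n)).1 h
    have h1 := finrank_span_singleton (K := ℂ) (v := η.1) (norm_ne_zero_iff.1 (by
      rw [norm_sphere]; exact one_ne_zero))
    rw [h', finrank_top, finrank_euclideanSpace_fin] at h1
    omega
  have hsub : Ioo (0 : ℝ) 1 • ((↑) '' {ξ : S n | ‖herm ξ.1 η.1‖ = 1} : Set (Cn n)) ⊆ (V : Set (Cn n)) := by
    rintro _ ⟨r, _, _, ⟨ξ, hξ, rfl⟩, rfl⟩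
    refine V.smul_mem r ?_
    rw [mem_ofPred_eq, herm_eq_inner] at hξ
    have hne : ∀ ξ : S n, ξ.1 ≠ 0 := fun ξ => norm_ne_zero_iff.1 (by
      rw [norm_sphere]; exact one_ne_zero)
    obtain ⟨c, _, hc⟩ := (norm_inner_eq_norm_iff (𝕜 := ℂ) (hne η) (hne ξ)).1 (by
      rw [norm_sphere, norm_sphere, mul_one, hξ])
    exact Submodule.mem_span_singleton.2 ⟨c, hc.symm⟩
  rw [surfaceMeasure, Measure.smul_apply, Measure.toSphere_apply' _ hm,
    measure_mono_null hsub (Measure.addHaar_submodule _ _ hV)]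
  simp

lemma ae_norm_herm_lt_one (hn : 2 ≤ n) (η : S n) :
    ∀ᵐ ξ ∂(surfaceMeasure n), ‖herm ξ.1 η.1‖ < 1 := by
  have h : ∀ᵐ ξ ∂(surfaceMeasure n), ¬ ‖herm ξ.1 η.1‖ = 1 := by
    rw [ae_iff]
    simpa using surfaceMeasure_norm_herm_eq_one hn η
  filter_upwards [h] with ξ hξ
  exact lt_of_le_of_ne (norm_herm_le_one ξ η) hξ

/-! ### The Funk–Hecke formula for zonal monomials -/

open MvPolynomial in
lemma isWeightedHomogeneous_zonal {p q : ℕ} {P : MvPolynomial (Fin n ⊕ Fin n) ℂ}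
    (hP : IsHarmonicPoly p q P) (u v : Fin n → ℂ) (j k : ℕ) :
    IsWeightedHomogeneous holWeight
      (P * linForm (Sum.elim v 0) ^ j * linForm (Sum.elim 0 u) ^ k) (p + j) := by
  have hA : IsWeightedHomogeneous (holWeight (n := n)) (linForm (Sum.elim v 0)) 1 := by
    refine (weightedHomogeneousSubmodule ℂ holWeight 1).sum_mem fun i _ => ?_
    rcases i with i | i
    · exact (isWeightedHomogeneous_X ℂ holWeight (.inl i)).C_mul _
    · simp
  have hB : IsWeightedHomogeneous (holWeight (n := n)) (linForm (Sum.elim 0 u)) 0 := by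
    refine (weightedHomogeneousSubmodule ℂ holWeight 0).sum_mem fun i _ => ?_
    rcases i with i | i
    · simp
    · exact (isWeightedHomogeneous_X ℂ holWeight (.inr i)).C_mul _
  simpa using (hP.hol.mul (hA.pow j)).mul (hB.pow k)

open MvPolynomial in
lemma evalAt_zonal (P : MvPolynomial (Fin n ⊕ Fin n) ℂ) (η z : Cn n) (j k : ℕ) :
    evalAt (P * linForm (Sum.elim (fun i => conj (η i)) 0) ^ j *
      linForm (Sum.elim 0 (fun i => η i)) ^ k) z =
      evalAt P z * (herm z η ^ j * conj (herm z η) ^ k) := by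
  have hA : evalAt (linForm (Sum.elim (fun i => conj (η i)) 0)) z = herm z η := by
    simp [evalAt, linForm, herm, mul_comm]
  have hB : evalAt (linForm (Sum.elim 0 (fun i => η i))) z = conj (herm z η) := by
    simp [evalAt, linForm, herm, mul_comm]
  rw [evalAt_mul, evalAt_mul, evalAt_pow, evalAt_pow, hA, hB, mul_assoc]

lemma surface_integral_zonal_monomial [NeZero n] {p q : ℕ} {F : Cn n → ℂ}
    (hF : F ∈ solidHarmonics n p q) (η : S n) (j k : ℕ) :
    ∫ ξ : S n, F ξ * (herm ξ.1 η.1 ^ j * conj (herm ξ.1 η.1) ^ k) ∂(surfaceMeasure n) =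
      (n - 1).factorial / (n - 1 + (p + j)).factorial *
        if j + p = k + q then (j.descFactorial q : ℂ) * k.factorial * F η else 0 := by
  obtain ⟨P, rfl, hP⟩ := exists_isHarmonicPoly hF
  simp only [← evalAt_zonal]
  rw [surface_integral_evalAt (isWeightedHomogeneous_zonal hP _ _ j k),
    gaussExp_harmonic_mul_pow (sum_mul_conj_eq_one η) j k hP]
  rfl

/-! ### The coefficients -/

/-- Log-convexity of the factorial. It bounds the terms of the coefficient series by Taylor
coefficients on a diagonal. -/
lemma factorial_mul_factorial_le (p q k : ℕ) :
    (p + k).factorial * (q + k).factorial ≤ k.factorial * (p + q + k).factorial := by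
  induction p with
  | zero => simp
  | succ p ih =>
    rw [show p + 1 + k = (p + k) + 1 by ring, show p + 1 + q + k = (p + q + k) + 1 by ring,
      Nat.factorial_succ, Nat.factorial_succ]
    calc (p + k + 1) * (p + k).factorial * (q + k).factorial
        = (p + k + 1) * ((p + k).factorial * (q + k).factorial) := by ring
      _ ≤ (p + q + k + 1) * (k.factorial * (p + q + k).factorial) :=
          Nat.mul_le_mul (by omega) ih
      _ = _ := by ring

lemma injective_add_add (p q : ℕ) : Function.Injective fun k : ℕ => (p + k, q + k) := fun k l h => by
  simpa using h

lemma summable_coeffTerm {φ : ℂ → ℂ} (hφ : IsAdmissibleProfile φ) (p q : ℕ) :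
    Summable (coeffTerm n φ p q) := by
  refine Summable.of_norm_bounded
    (hφ.summable_taylorCoeff.comp_injective (injective_add_add p q)) fun k => ?_
  simp only [coeffTerm, taylorCoeff, Function.comp_apply, norm_div, norm_mul, Complex.norm_natCast]
  refine div_le_div_of_nonneg_left (norm_nonneg _) (by positivity) ?_
  have h1 := factorial_mul_factorial_le p q k
  have h2 : (p + q + k).factorial ≤ (n - 1 + p + q + k).factorial := Nat.factorial_le (by omega)
  exact_mod_cast h1.trans (Nat.mul_le_mul_left _ h2)

/-- The support lies on the diagonal `(q + m, p + m)`, where the factorials from the Taylor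
coefficient cancel down to `m!`. -/
lemma tsum_zonal {φ : ℂ → ℂ} (p q : ℕ) (y : ℂ) :
    ∑' jk : ℕ × ℕ, taylorCoeff φ jk * ((n - 1).factorial / (n - 1 + (p + jk.1)).factorial *
      if jk.1 + p = jk.2 + q then (jk.1.descFactorial q : ℂ) * jk.2.factorial * y else 0) =
      coeff n φ q p * y := by
  rw [← (injective_add_add q p).tsum_eq, coeff, mul_assoc, ← tsum_mul_right, ← tsum_mul_left]
  · refine tsum_congr fun m => ?_
    rw [if_pos (by ring), coeffTerm, taylorCoeff]
    have h1 : (m.factorial : ℂ) * (q + m).descFactorial q = (q + m).factorial := by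
      have := Nat.factorial_mul_descFactorial (Nat.le_add_right q m)
      rw [Nat.add_sub_cancel_left] at this
      exact_mod_cast this
    have hm : (m.factorial : ℂ) ≠ 0 := by exact_mod_cast m.factorial_ne_zero
    have hq : ((q + m).factorial : ℂ) ≠ 0 := by exact_mod_cast (q + m).factorial_ne_zero
    have hp : ((p + m).factorial : ℂ) ≠ 0 := by exact_mod_cast (p + m).factorial_ne_zero
    have hN : ((n - 1 + q + p + m).factorial : ℂ) ≠ 0 := by exact_mod_cast Nat.factorial_ne_zero _
    rw [show n - 1 + (p + (q + m)) = n - 1 + q + p + m by ring]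
    field_simp
    rw [← h1]
    ring
  · rintro ⟨j, k⟩ hjk
    rw [Function.mem_support] at hjk
    simp only at hjk
    have h1 : j + p = k + q := by
      by_contra h
      simp [h] at hjk
    have h2 : q ≤ j := by
      by_contra h
      simp [Nat.descFactorial_eq_zero_iff_lt.2 (not_le.1 h)] at hjk
    exact ⟨j - q, by simp only [Prod.mk.injEq]; omega⟩

/-! ### The Funk–Hecke formula -/

lemma continuous_solidHarmonic {p q : ℕ} {F : Cn n → ℂ} (hF : F ∈ solidHarmonics n p q) :
    Continuous F := by
  obtain ⟨P, rfl, _⟩ := exists_isHarmonicPoly hF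
  exact continuous_evalAt P

theorem funkHecke_solidHarmonic (hn : 2 ≤ n) (η : S n) {φ : ℂ → ℂ} (hφ : IsAdmissibleProfile φ)
    {p q : ℕ} {F : Cn n → ℂ} (hF : F ∈ solidHarmonics n p q) :
    Integrable (fun ξ : S n => F ξ * φ (herm ξ.1 η.1)) (surfaceMeasure n) ∧
      ∫ ξ : S n, F ξ * φ (herm ξ.1 η.1) ∂(surfaceMeasure n) = coeff n φ q p * F η := by
  have : NeZero n := ⟨by omega⟩
  have hFc : Continuous fun ξ : S n => F ξ := (continuous_solidHarmonic hF).comp continuous_subtype_val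
  obtain ⟨M, hM⟩ : ∃ M, ∀ ξ : S n, ‖F ξ‖ ≤ M := by
    obtain ⟨M, hM⟩ := (isCompact_range hFc).isBounded.exists_norm_le
    exact ⟨M, fun ξ => hM _ (mem_range_self ξ)⟩
  have hM0 : 0 ≤ M := (norm_nonneg _).trans (hM η)
  let T : ℕ × ℕ → S n → ℂ := fun jk ξ =>
    taylorCoeff φ jk * (F ξ * (herm ξ.1 η.1 ^ jk.1 * conj (herm ξ.1 η.1) ^ jk.2))
  have hTc : ∀ jk, Continuous (T jk) := fun jk =>
    continuous_const.mul (hFc.mul (((continuous_herm η).pow _).mul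
      ((Complex.continuous_conj.comp (continuous_herm η)).pow _)))
  have hTb : ∀ jk ξ, ‖T jk ξ‖ ≤ ‖taylorCoeff φ jk‖ * M := fun jk ξ => by
    rw [norm_mul, norm_mul]
    refine mul_le_mul_of_nonneg_left ?_ (norm_nonneg _)
    exact (mul_le_of_le_one_right (norm_nonneg _)
      (norm_pow_mul_conj_pow_le (norm_herm_le_one ξ η) _ _)).trans (hM ξ)
  have hTs : Summable fun jk => ‖taylorCoeff φ jk‖ * M := hφ.summable_taylorCoeff.mul_right M
  -- On the unit circle the profile may differ from its Taylor series, but only on a null set of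
  -- `ξ`. Integrability then comes from the continuous sum.
  have hae : (fun ξ => ∑' jk, T jk ξ) =ᵐ[surfaceMeasure n]
      fun ξ : S n => F ξ * φ (herm ξ.1 η.1) := by
    filter_upwards [ae_norm_herm_lt_one hn η] with ξ hξ
    rw [hφ.eq_tsum hξ, ← tsum_mul_left]
    exact tsum_congr fun jk => mul_left_comm _ _ _
  have hTi : ∀ jk, Integrable (T jk) (surfaceMeasure n) := fun jk =>
    integrable_of_continuous_sphere (hTc jk)
  refine ⟨(integrable_of_continuous_sphere (continuous_tsum hTc hTs hTb)).congr hae, ?_⟩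
  rw [← integral_congr_ae hae, ← tsum_zonal p q (F η)]
  have hsum : Summable fun jk => ∫ ξ, ‖T jk ξ‖ ∂(surfaceMeasure n) := by
    refine Summable.of_nonneg_of_le (fun jk => integral_nonneg fun ξ => norm_nonneg _)
      (fun jk => ?_) hTs
    refine (integral_mono (hTi jk).norm (integrable_const _) (hTb jk)).trans ?_
    simp
  rw [← (hasSum_integral_of_summable_integral_norm hTi hsum).tsum_eq]
  refine tsum_congr fun jk => ?_
  rw [← surface_integral_zonal_monomial hF, ← integral_const_mul]

end ComplexSphere

end

theorem mainTheorem3 (n : ℕ) (hn : 2 ≤ n) (η : ComplexSphere.S n)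
    (φ : ℂ → ℂ) (hφ : ComplexSphere.IsAdmissibleProfile φ)
    (f : ComplexSphere.S n → ℂ) (hf : ∀ ξ : ComplexSphere.S n, f ξ = φ (ComplexSphere.herm ξ.1 η.1)) :
    (∀ p q : ℕ, Summable (ComplexSphere.coeffTerm n φ p q)) ∧
    ∀ (p q : ℕ), ∀ Y ∈ ComplexSphere.surfaceHarmonics n p q,
      Integrable (fun ξ => conj (Y ξ) * f ξ) (ComplexSphere.surfaceMeasure n) ∧
      ∫ ξ, conj (Y ξ) * f ξ ∂(ComplexSphere.surfaceMeasure n) =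
        ComplexSphere.coeff n φ p q * conj (Y η) ∧
      Integrable (fun ξ => Y ξ * f ξ) (ComplexSphere.surfaceMeasure n) ∧
      ∫ ξ, Y ξ * f ξ ∂(ComplexSphere.surfaceMeasure n) =
        ComplexSphere.coeff n φ q p * Y η := by
  refine ⟨ComplexSphere.summable_coeffTerm hφ, ?_⟩
  rintro p q Y ⟨F, hF, hY⟩
  simp only [hf, hY]
  obtain ⟨h1, h2⟩ := ComplexSphere.funkHecke_solidHarmonic hn η hφ hF
  -- Conjugation exchanges the bidegree to `(q, p)`, which accounts for the two orders of the
  -- coefficient indices.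
  obtain ⟨h3, h4⟩ := ComplexSphere.funkHecke_solidHarmonic hn η hφ
    (ComplexSphere.conj_mem_solidHarmonics hF)
  exact ⟨h3, h4, h1, h2⟩
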